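/- For $x\in\mathbb Z$ let $\rho_x$ be the law of the labeled plane Galton--Watson tree with offspring distribution $\mathrm{Geom}(1/2)$ (that is, $n$ children with probability $2^{-n-1}$, $n\ge 0$), in which the root has label $x$ and the label of any other vertex is uniform in $\{\ell-1,\ell,\ell+1\}$, $\ell$ being the label of its parent. Let $\theta_\infty=(T_\infty,l_\infty)$ be the uniform infinite labeled tree: the random labeled rooted plane tree with a unique infinite spine $s_0,s_1,\dots$ starting at the root $s_0$, such that the spine labels $S_i=l_\infty(s_i)$ form a random walk started from $S_0=0$ with independent uniform steps in $\{-1,0,1\}$ and, conditionally on $(S_i)_{i\ge0}$, the subtrees $L_i$ and $R_i$ attached to $s_i$ on the left and on the right of the spine are independent, with law $\rho_{S_i}$. For $k\ge 1$ let $e_k$ be the first corner of $T_\infty$ after the root corner, in clockwise (depth-first) order, whose label is $-k$; it exists almost surely. Let $x_0,x_1,\dots,x_m$ be the vertices on the path in $T_\infty$ from the vertex of $e_k$ (which is $x_0$) to the root (which is $x_m$), and let $X^{(k)}_{\infty,i}=l_\infty(x_i)+k$ for $0\le i\le m$. (Almost surely $m\ge k$, so that $X^{(k)}_{\infty,1},\dots,X^{(k)}_{\infty,r}$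 are defined as soon as $k\ge r$.) Let $\tilde X=(\tilde X_n)_{n\ge0}$ be the Markov chain on $\{1,2,3,\dots\}$ started from $\tilde X_0=1$, with transition probabilities $$\mathbb P(\tilde X_{n+1}=x+1\mid\tilde X_n=x)=\frac{(x+4)(2x+5)}{3(x+2)(2x+3)},\qquad \mathbb P(\tilde X_{n+1}=x\mid\tilde X_n=x)=\frac{x(x+3)}{3(x+1)(x+2)},$$ $$\mathbb P(\tilde X_{n+1}=x-1\mid\tilde X_n=x)=\frac{(x-1)(2x+1)}{3(x+1)(2x+3)}.$$ Then for every fixed $r$ and every bounded continuous function $F:\mathbb R^r\to\mathbb R$, $$\mathbb E\big[F(X^{(k)}_{\infty,1},\dots,X^{(k)}_{\infty,r})\big]\longrightarrow \mathbb E\big[F(\tilde X_0,\dots,\tilde X_{r-1})\big]\qquad (k\to\infty).$$ That is, the first $r$ labels along the branch from $e_k$ to the root (after $e_k$ itself) converge in distribution to the first $r$ values of the chain $\tilde X$ started at $1$. -/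

import Mathlib

open MeasureTheory ProbabilityTheory Filter Topology
open scoped ENNReal BoundedContinuousFunction

noncomputable section

namespace UIPQ

/-! ### Labeled plane trees -/

/-- A locally finite rooted plane tree with integer labels, in the Ulam--Harris encoding. Vertices
are words `u : List ℕ`: the root is `[]`, and `u ++ [i]` is the `i`-th child of `u`, counted from
the left starting at `0`. `children u` is the number of children of `u` and `label u` is its label;
the values of these functions at words that are not vertices play no role. -/
structure LabeledTree where
  children : List ℕ → ℕ
  label : List ℕ → ℤ

/-- The word `u` is a vertex of the tree `θ`. -/
def LabeledTree.IsVertex (θ : LabeledTree) (u : List ℕ) : Prop :=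
  ∀ (v : List ℕ) (i : ℕ), v ++ [i] <+: u → i < θ.children v

/-- `u` is the first vertex of `θ` with label `y` in depth-first order, that is, in the
lexicographic order on words. When it has finitely many predecessors (as it does for every tree
with a unique spine along which the labels are unbounded below, if `y` is negative and the root has
label `0`), the first visit of `u` in the clockwise contour of the tree is the first corner with
label `y` after the root corner. -/
def LabeledTree.IsFirstWithLabel (θ : LabeledTree) (y : ℤ) (u : List ℕ) : Prop :=
  θ.IsVertex u ∧ θ.label u = y ∧ ∀ v, θ.IsVertex v → v < u → θ.label v ≠ y

open Classical in
/-- The vertex `e_k(θ)` carrying the first corner with label `-k` after the root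
(the root itself, by convention, if no vertex has label `-k`). -/
def LabeledTree.firstHit (θ : LabeledTree) (k : ℕ) : List ℕ :=
  if h : ∃ u, θ.IsFirstWithLabel (-(k : ℤ)) u then h.choose else []

/-- The vertex `x_i` at distance `i` from `e_k` on the path from `e_k` to the root: the `i`-th
ancestor of `e_k` (the root itself, by convention, if `i` exceeds the height of `e_k`). -/
def LabeledTree.branch (θ : LabeledTree) (k i : ℕ) : List ℕ :=
  List.dropLast^[i] (θ.firstHit k)

/-- The shifted label `X_i^{(k)} = l(x_i) + k` of the `i`-th vertex on the branch from `e_k` to the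
root. -/
def LabeledTree.branchLabel (θ : LabeledTree) (k i : ℕ) : ℤ :=
  θ.label (θ.branch k i) + k

/-! ### Galton--Watson trees -/

/-- The randomness in a labeled Galton--Watson tree: a number of children and a label increment
for every word. -/
abbrev GWField : Type := List ℕ → ℕ × ℤ

/-- The uniform distribution on `{-1, 0, 1}`. -/
def stepLaw : Measure ℤ :=
  (PMF.uniformOfFinset ({-1, 0, 1} : Finset ℤ) (by simp)).toMeasure

instance : IsProbabilityMeasure stepLaw := by
  unfold stepLaw; infer_instance

/-- The geometric distribution `n ↦ 2⁻⁽ⁿ⁺¹⁾` on `{0, 1, 2, …}`. -/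
def offspringLaw : Measure ℕ :=
  geometricMeasure ⟨1 / 2, by constructor <;> norm_num⟩

instance : IsProbabilityMeasure offspringLaw := by
  unfold offspringLaw; infer_instance

/-- All numbers of children and all label increments are independent, the former geometric and
the latter uniform on `{-1, 0, 1}`. -/
def gwFieldLaw : Measure GWField :=
  Measure.infinitePi fun _ => offspringLaw.prod stepLaw

instance : IsProbabilityMeasure gwFieldLaw := by
  unfold gwFieldLaw; infer_instance

/-- The label of a word when the root has label `x`: the label of a vertex is that of its parent
plus the increment attached to the vertex. -/
def gwLabel : GWField → ℤ → List ℕ → ℤ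
  | _, x, [] => x
  | g, x, i :: u => gwLabel (fun v => g (i :: v)) (x + (g [i]).2) u

/-- The labeled tree with root label `x` built from `g`. Under `gwFieldLaw` its law is that of a
Galton--Watson tree with geometric offspring distribution of parameter `1/2` and uniform label
increments in `{-1, 0, 1}`. -/
def gwTree (x : ℤ) (g : GWField) : LabeledTree where
  children u := (g u).1
  label u := gwLabel g x u

/-! ### The uniform infinite labeled tree -/

/-- Number of children in the tree with a single spine `s_0, s_1, …` (`s_0` the root) in which
`L j` is grafted at `s_j` to the left of the spine and `R j` to its right, of the vertex whose word
relative to `s_j` is `u`. The children of `s_j` are, from left to right, those of the root of `L j`,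
then `s_{j+1}`, then those of the root of `R j`. -/
def graftChildren (L R : ℕ → LabeledTree) : ℕ → List ℕ → ℕ
  | j, [] => (L j).children [] + 1 + (R j).children []
  | j, i :: u =>
    if i < (L j).children [] then (L j).children (i :: u)
    else if i = (L j).children [] then graftChildren L R (j + 1) u
    else (R j).children ((i - ((L j).children [] + 1)) :: u)

/-- The labels in the same tree, those of `L j` and `R j` being kept; both have the label of `s_j`
as root label. -/
def graftLabel (L R : ℕ → LabeledTree) : ℕ → List ℕ → ℤ
  | j, [] => (L j).label []
  | j, i :: u =>
    if i < (L j).children [] then (L j).label (i :: u)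
    else if i = (L j).children [] then graftLabel L R (j + 1) u
    else (R j).label ((i - ((L j).children [] + 1)) :: u)

/-- The tree with a single spine, with `L j` and `R j` to the left and to the right of its `j`-th
vertex. -/
def graft (L R : ℕ → LabeledTree) : LabeledTree where
  children := graftChildren L R 0
  label := graftLabel L R 0

/-- The sample space of the uniform infinite labeled tree: the increments of the labels along the
spine, and the randomness in the trees to the left and to the right of the spine. -/
abbrev Sample : Type := (ℕ → ℤ) × (ℕ → GWField) × (ℕ → GWField)

/-- All of these are independent. -/
def sampleLaw : Measure Sample :=
  (Measure.infinitePi fun _ => stepLaw).prod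
    ((Measure.infinitePi fun _ => gwFieldLaw).prod (Measure.infinitePi fun _ => gwFieldLaw))

instance : IsProbabilityMeasure sampleLaw := by
  unfold sampleLaw; infer_instance

/-- The label `S_j` of the `j`-th spine vertex: a random walk from `0` with uniform steps in
`{-1, 0, 1}`. -/
def spineLabel (ω : Sample) (j : ℕ) : ℤ := ∑ i ∈ Finset.range j, ω.1 i

/-- The uniform infinite labeled tree `θ_∞`: the spine labels form a random walk and, conditionally
on them, the trees `L_j` and `R_j` are independent labeled Galton--Watson trees with root
label `S_j`. -/
def uniformInfiniteTree (ω : Sample) : LabeledTree :=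
  graft (fun j => gwTree (spineLabel ω j) (ω.2.1 j)) (fun j => gwTree (spineLabel ω j) (ω.2.2 j))

/-- The random vector `(X_{∞,1}^{(k)}, …, X_{∞,r}^{(k)})`. -/
def firstLabels (r k : ℕ) (ω : Sample) : Fin r → ℝ :=
  fun i => ((uniformInfiniteTree ω).branchLabel k (i + 1) : ℝ)

/-! ### The limiting Markov chain -/

/-- Probability of a step from `x` to `x + 1`. -/
def probUp (x : ℕ) : ℝ := ((x + 4) * (2 * x + 5)) / (3 * (x + 2) * (2 * x + 3))

/-- Probability of a step from `x` to `x`. -/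
def probStay (x : ℕ) : ℝ := (x * (x + 3)) / (3 * (x + 1) * (x + 2))

/-- Probability of a step from `x` to `x - 1`. -/
def probDown (x : ℕ) : ℝ := ((x - 1) * (2 * x + 1)) / (3 * (x + 1) * (2 * x + 3))

/-- The transition probabilities of the chain on the positive integers. The state `0`, which cannot
be reached from the positive integers since `probDown 1 = 0`, is made absorbing by convention. -/
def chainStep (x : ℕ) : Measure ℕ :=
  if x = 0 then Measure.dirac 0
  else ENNReal.ofReal (probUp x) • Measure.dirac (x + 1)
    + ENNReal.ofReal (probStay x) • Measure.dirac x
    + ENNReal.ofReal (probDown x) • Measure.dirac (x - 1)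

instance (x : ℕ) : IsProbabilityMeasure (chainStep x) := by
  constructor
  unfold chainStep
  split_ifs with h
  · simp
  · have hx : (1 : ℝ) ≤ x := by exact_mod_cast Nat.one_le_iff_ne_zero.mpr h
    have h1 : 0 ≤ probUp x := by unfold probUp; positivity
    have h2 : 0 ≤ probStay x := by unfold probStay; positivity
    have h3 : 0 ≤ probDown x := by
      unfold probDown
      have : (0 : ℝ) ≤ x - 1 := by linarith
      positivity
    simp only [Measure.coe_add, Measure.coe_smul, Pi.add_apply, Pi.smul_apply, measure_univ,
      smul_eq_mul, mul_one]
    rw [← ENNReal.ofReal_add h1 h2, ← ENNReal.ofReal_add (add_nonneg h1 h2) h3,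
      ENNReal.ofReal_eq_one]
    unfold probUp probStay probDown
    field_simp
    ring

/-- The transition kernel of the chain, as a function of the path up to time `n`. -/
def chainKernel (n : ℕ) : Kernel (Finset.Iic n → ℕ) ℕ :=
  (Kernel.ofFunOfCountable chainStep).comap
    (fun h : Finset.Iic n → ℕ => h ⟨n, by simp⟩) (measurable_pi_apply _)

instance (n : ℕ) : IsMarkovKernel (chainKernel n) := by
  have : IsMarkovKernel (Kernel.ofFunOfCountable chainStep) :=
    ⟨fun x => inferInstanceAs (IsProbabilityMeasure (chainStep x))⟩
  unfold chainKernel; infer_instance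

/-- The law of the Markov chain `(X̃_n)_{n ≥ 0}` started from `1`, on its path space. -/
def chainLaw : Measure (ℕ → ℕ) :=
  Kernel.trajMeasure (X := fun _ => ℕ) (Measure.dirac 1) chainKernel

end UIPQ

end

/-!
After increasing all labels by `k`, the root has label `k` and `e_k` is the first vertex with label
`0`, so that the subtrees on the left of its branch avoid `0`. The probability `w x` that a labeled
Galton-Watson tree with root label `x` avoids `0` is the only solution with values in `[0, 1]` of
`w 0 = 0` and `w x = (2 - (w (x - 1) + w x + w (x + 1)) / 3)⁻¹`, namely
`w x = x (x + 3) / ((x + 1) (x + 2))`. Hence every vertex with label `x` on the branch contributes a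
factor `w x`, and the branch is a random walk weighted by these factors, with one-step operator
`T f x = w x * (f (x - 1) + f x + f (x + 1)) / 3`.

In the infinite tree, a branch of length `m` may leave the spine at any of `m + 1` heights, each
with the same weight. The branches ending with prescribed labels `c r, …, c 1, 0` have the weight of
this final walk multiplied by at least `∑ (n + 1) T ^ n δ (k) = G ^ 2 δ (k)`, where `G = ∑ T ^ n`
and `δ` is the point mass at `c r`. As `k → ∞`, `G ^ 2 δ (k)` converges to a limit which is a cubic
polynomial in `c r ≥ 1`, and the Markov chain of the theorem is the corresponding h-transform of
`T`. The limits of the lower bounds are therefore the point masses of the chain. As these add up to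
one, the lower bounds give the convergence in distribution.
-/

noncomputable section

namespace UIPQ

/-! ### Depth-first search from the root -/

namespace LabeledTree

/-- The tree of the descendants of the `i`-th child of the root. -/
def subtree (θ : LabeledTree) (i : ℕ) : LabeledTree where
  children u := θ.children (i :: u)
  label u := θ.label (i :: u)

/-- The tree `θ` with all labels increased by `z`. -/
@[simps]
def raise (θ : LabeledTree) (z : ℤ) : LabeledTree where
  children := θ.children
  label u := θ.label u + z

/-- No vertex of `θ` has label `y`. -/
def Avoids (θ : LabeledTree) (y : ℤ) : Prop :=
  ∀ v, θ.IsVertex v → θ.label v ≠ y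

/-- The first vertex of `θ` with label `0` in depth-first order exists, it has height `m`, and for
every `i ≤ m` the label of its `i`-th ancestor, which is its prefix of length `m - i`, is a natural
number in `C i`. -/
def HitsAlong (θ : LabeledTree) (C : ℕ → Set ℕ) (m : ℕ) : Prop :=
  ∃ u, θ.IsFirstWithLabel 0 u ∧ u.length = m ∧
    ∀ i ≤ m, ∃ a ∈ C i, θ.label (u.take (m - i)) = a

theorem isVertex_nil (θ : LabeledTree) : θ.IsVertex [] := by
  intro v i h
  simp at h

theorem isVertex_cons {θ : LabeledTree} {i : ℕ} {u : List ℕ} :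
    θ.IsVertex (i :: u) ↔ i < θ.children [] ∧ (θ.subtree i).IsVertex u := by
  constructor
  · intro h
    exact ⟨h [] i (by simp), fun v j hv => h (i :: v) j (by simpa using hv)⟩
  · rintro ⟨hi, h⟩ v j hv
    cases v with
    | nil =>
      obtain rfl : j = i := by simpa using hv
      exact hi
    | cons a v =>
      obtain ⟨rfl, hv'⟩ : a = i ∧ v ++ [j] <+: u := by simpa using hv
      exact h v j hv'

theorem avoids_iff {θ : LabeledTree} {y : ℤ} :
    θ.Avoids y ↔ θ.label [] ≠ y ∧ ∀ i < θ.children [], (θ.subtree i).Avoids y := by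
  constructor
  · intro h
    exact ⟨h [] θ.isVertex_nil, fun i hi v hv => h (i :: v) (isVertex_cons.2 ⟨hi, hv⟩)⟩
  · rintro ⟨hroot, h⟩ v hv
    cases v with
    | nil => exact hroot
    | cons i v =>
      obtain ⟨hi, hv⟩ := isVertex_cons.1 hv
      exact h i hi v hv

theorem isFirstWithLabel_nil {θ : LabeledTree} {y : ℤ} :
    θ.IsFirstWithLabel y [] ↔ θ.label [] = y :=
  ⟨fun h => h.2.1, fun h => ⟨θ.isVertex_nil, h, fun v _ hv => absurd hv (List.not_lt_nil v)⟩⟩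

theorem isFirstWithLabel_cons {θ : LabeledTree} {y : ℤ} {i : ℕ} {u : List ℕ} :
    θ.IsFirstWithLabel y (i :: u) ↔ θ.label [] ≠ y ∧ i < θ.children [] ∧
      (∀ j < i, (θ.subtree j).Avoids y) ∧ (θ.subtree i).IsFirstWithLabel y u := by
  constructor
  · rintro ⟨hv, hlabel, hfirst⟩
    obtain ⟨hi, hu⟩ := isVertex_cons.1 hv
    refine ⟨hfirst [] θ.isVertex_nil (List.nil_lt_cons _ _), hi, fun j hj v hv => ?_, hu, hlabel,
      fun v hv hlt => ?_⟩
    · exact hfirst (j :: v) (isVertex_cons.2 ⟨hj.trans hi, hv⟩)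
        (List.cons_lt_cons_iff.2 (Or.inl hj))
    · exact hfirst (i :: v) (isVertex_cons.2 ⟨hi, hv⟩)
        (List.cons_lt_cons_iff.2 (Or.inr ⟨rfl, hlt⟩))
  · rintro ⟨hroot, hi, havoid, hu, hlabel, hfirst⟩
    refine ⟨isVertex_cons.2 ⟨hi, hu⟩, hlabel, fun v hv hlt => ?_⟩
    cases v with
    | nil => exact hroot
    | cons j v =>
      obtain ⟨-, hv⟩ := isVertex_cons.1 hv
      rcases List.cons_lt_cons_iff.1 hlt with h | ⟨rfl, h⟩
      · exact havoid j h v hv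
      · exact hfirst v hv h

theorem IsFirstWithLabel.unique {θ : LabeledTree} {y : ℤ} {u v : List ℕ}
    (hu : θ.IsFirstWithLabel y u) (hv : θ.IsFirstWithLabel y v) : u = v := by
  rcases lt_trichotomy u v with h | h | h
  · exact absurd hu.2.1 (hv.2.2 u hu.1 h)
  · exact h
  · exact absurd hv.2.1 (hu.2.2 v hv.1 h)

theorem IsFirstWithLabel.firstHit_eq {θ : LabeledTree} {k : ℕ} {u : List ℕ}
    (hu : θ.IsFirstWithLabel (-(k : ℤ)) u) : θ.firstHit k = u := by
  have h : ∃ u, θ.IsFirstWithLabel (-(k : ℤ)) u := ⟨u, hu⟩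
  rw [firstHit, dif_pos h]
  exact h.choose_spec.unique hu

theorem firstHit_eq_iff {θ : LabeledTree} {k : ℕ} {u : List ℕ} :
    θ.firstHit k = u ↔ θ.IsFirstWithLabel (-(k : ℤ)) u ∨
      (u = [] ∧ ∀ v, ¬ θ.IsFirstWithLabel (-(k : ℤ)) v) := by
  by_cases hex : ∃ v, θ.IsFirstWithLabel (-(k : ℤ)) v
  · obtain ⟨v, hv⟩ := hex
    rw [hv.firstHit_eq]
    exact ⟨fun h => Or.inl (h ▸ hv),
      fun h => h.elim hv.unique fun hnone => absurd hv (hnone.2 v)⟩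
  · rw [firstHit, dif_neg hex]
    rw [not_exists] at hex
    exact ⟨fun h => Or.inr ⟨h.symm, hex⟩,
      fun h => h.elim (fun hu => absurd hu (hex u)) fun hnone => hnone.1.symm⟩

theorem isFirstWithLabel_raise {θ : LabeledTree} {y z : ℤ} {u : List ℕ} :
    (θ.raise z).IsFirstWithLabel y u ↔ θ.IsFirstWithLabel (y - z) u := by
  simp only [IsFirstWithLabel, IsVertex, raise, ne_eq, eq_sub_iff_add_eq]

theorem raise_raise (θ : LabeledTree) (z w : ℤ) : (θ.raise z).raise w = θ.raise (z + w) := by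
  simp only [raise, add_assoc]

theorem HitsAlong.height_unique {θ : LabeledTree} {C C' : ℕ → Set ℕ} {m m' : ℕ}
    (h : θ.HitsAlong C m) (h' : θ.HitsAlong C' m') : m = m' := by
  obtain ⟨u, hu, rfl, -⟩ := h
  obtain ⟨v, hv, rfl, -⟩ := h'
  rw [hu.unique hv]

theorem HitsAlong.not_avoids {θ : LabeledTree} {C : ℕ → Set ℕ} {m : ℕ}
    (h : θ.HitsAlong C m) : ¬ θ.Avoids 0 := by
  obtain ⟨u, hu, -⟩ := h
  exact fun havoid => havoid u hu.1 hu.2.1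

theorem hitsAlong_zero {θ : LabeledTree} {C : ℕ → Set ℕ} :
    θ.HitsAlong C 0 ↔ θ.label [] = 0 ∧ 0 ∈ C 0 := by
  constructor
  · rintro ⟨u, hu, hlength, hC⟩
    obtain rfl := List.eq_nil_of_length_eq_zero hlength
    have hlabel := isFirstWithLabel_nil.1 hu
    obtain ⟨a, ha, hroot⟩ := hC 0 le_rfl
    obtain rfl : a = 0 := by simpa [hlabel] using hroot.symm
    exact ⟨hlabel, ha⟩
  · rintro ⟨hlabel, h0⟩
    refine ⟨[], isFirstWithLabel_nil.2 hlabel, rfl, fun i hi => ⟨0, ?_, by simpa using hlabel⟩⟩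
    rwa [Nat.le_zero.1 hi]

theorem hitsAlong_succ {θ : LabeledTree} {C : ℕ → Set ℕ} {m : ℕ} :
    θ.HitsAlong C (m + 1) ↔ (∃ a ∈ C (m + 1), a ≠ 0 ∧ θ.label [] = a) ∧
      ∃ i < θ.children [], (∀ j < i, (θ.subtree j).Avoids 0) ∧ (θ.subtree i).HitsAlong C m := by
  constructor
  · rintro ⟨_ | ⟨i, u⟩, hu, hlength, hC⟩
    · simp at hlength
    obtain ⟨hroot, hi, havoid, hfirst⟩ := isFirstWithLabel_cons.1 hu
    obtain ⟨a, ha, hlabel⟩ := hC (m + 1) le_rfl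
    rw [Nat.sub_self, List.take_zero] at hlabel
    refine ⟨⟨a, ha, fun h => hroot (by simp [hlabel, h]), hlabel⟩, i, hi, havoid, u, hfirst,
      by simpa using hlength, fun j hj => ?_⟩
    have := hC j (by lia)
    rwa [Nat.succ_sub hj] at this
  · rintro ⟨⟨a, ha, ha0, hlabel⟩, i, hi, havoid, u, hfirst, hlength, hC⟩
    refine ⟨i :: u, isFirstWithLabel_cons.2 ⟨?_, hi, havoid, hfirst⟩, by simp [hlength],
      fun j hj => ?_⟩
    · rw [hlabel]
      exact_mod_cast ha0
    · rcases hj.lt_or_eq with hj | rfl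
      · rw [Nat.succ_sub (by lia)]
        exact hC j (by lia)
      · exact ⟨a, ha, by rwa [Nat.sub_self, List.take_zero]⟩

theorem iterate_dropLast (i : ℕ) (u : List ℕ) :
    List.dropLast^[i] u = u.take (u.length - i) := by
  induction i with
  | zero => simp
  | succ i ih =>
    rw [Function.iterate_succ_apply', ih, List.dropLast_eq_take, List.take_take, List.length_take]
    congr 1
    lia

theorem HitsAlong.branchLabel_eq {θ : LabeledTree} {k : ℕ} {C : ℕ → Set ℕ} {m : ℕ}
    (h : (θ.raise k).HitsAlong C m) {i : ℕ} (hi : i ≤ m) :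
    ∃ a ∈ C i, θ.branchLabel k i = a := by
  obtain ⟨u, hu, rfl, hC⟩ := h
  have hfirst : θ.IsFirstWithLabel (-(k : ℤ)) u := by simpa using isFirstWithLabel_raise.1 hu
  simpa only [branchLabel, branch, hfirst.firstHit_eq, iterate_dropLast, raise_label]
    using hC i hi

end LabeledTree

theorem gwTree_add (x z : ℤ) (g : GWField) : gwTree (x + z) g = (gwTree x g).raise z := by
  have hlabel (u : List ℕ) : gwLabel g (x + z) u = gwLabel g x u + z := by
    induction u generalizing g x with
    | nil => rfl
    | cons i u ih => simp only [gwLabel, add_right_comm x z, ih]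
  simp only [gwTree, LabeledTree.raise, hlabel]

theorem graft_raise (L R : ℕ → LabeledTree) (z : ℤ) :
    graft (fun j => (L j).raise z) (fun j => (R j).raise z) = (graft L R).raise z := by
  have hchildren (j : ℕ) (u : List ℕ) :
      graftChildren (fun j => (L j).raise z) (fun j => (R j).raise z) j u
        = graftChildren L R j u := by
    induction u generalizing j with
    | nil => rfl
    | cons i u ih => simp only [graftChildren, ih, LabeledTree.raise_children]
  have hlabel (j : ℕ) (u : List ℕ) :
      graftLabel (fun j => (L j).raise z) (fun j => (R j).raise z) j u
        = graftLabel L R j u + z := by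
    induction u generalizing j with
    | nil => rfl
    | cons i u ih =>
      simp only [graftLabel, ih, LabeledTree.raise_children, LabeledTree.raise_label]
      split_ifs <;> rfl
  simp only [graft, LabeledTree.raise, LabeledTree.mk.injEq]
  exact ⟨funext (hchildren 0), funext (hlabel 0)⟩

theorem graft_subtree_left (L R : ℕ → LabeledTree) {i : ℕ} (hi : i < (L 0).children []) :
    (graft L R).subtree i = (L 0).subtree i := by
  simp [graft, LabeledTree.subtree, graftChildren, graftLabel, hi]

theorem graft_subtree_spine (L R : ℕ → LabeledTree) :
    (graft L R).subtree ((L 0).children []) =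
      graft (fun n => L (n + 1)) (fun n => R (n + 1)) := by
  have hchildren (j : ℕ) (u : List ℕ) : graftChildren L R (j + 1) u
      = graftChildren (fun n => L (n + 1)) (fun n => R (n + 1)) j u := by
    induction u generalizing j with
    | nil => rfl
    | cons i u ih => simp only [graftChildren, ih]
  have hlabel (j : ℕ) (u : List ℕ) : graftLabel L R (j + 1) u
      = graftLabel (fun n => L (n + 1)) (fun n => R (n + 1)) j u := by
    induction u generalizing j with
    | nil => rfl
    | cons i u ih => simp only [graftLabel, ih]
  simp [graft, LabeledTree.subtree, graftChildren, graftLabel, hchildren, hlabel]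

/-- The randomness in the part of the tree above the second spine vertex. -/
def shift (ω : Sample) : Sample :=
  (fun n => ω.1 (n + 1), fun n => ω.2.1 (n + 1), fun n => ω.2.2 (n + 1))

theorem uniformInfiniteTree_subtree_left (ω : Sample) {i : ℕ} (hi : i < (ω.2.1 0 []).1) :
    (uniformInfiniteTree ω).subtree i = (gwTree 0 (ω.2.1 0)).subtree i :=
  graft_subtree_left (fun j => gwTree (spineLabel ω j) (ω.2.1 j)) _ hi

theorem uniformInfiniteTree_subtree_spine (ω : Sample) :
    (uniformInfiniteTree ω).subtree (ω.2.1 0 []).1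
      = (uniformInfiniteTree (shift ω)).raise (ω.1 0) := by
  have hspine (j : ℕ) : spineLabel ω (j + 1) = spineLabel (shift ω) j + ω.1 0 :=
    Finset.sum_range_succ' _ _
  refine (graft_subtree_spine _ _).trans ?_
  simp only [hspine, gwTree_add]
  exact graft_raise _ _ _

theorem hitsAlong_of_left {x : ℕ} {ω : Sample} {C : ℕ → Set ℕ} {m : ℕ}
    (h : (gwTree x (ω.2.1 0)).HitsAlong C (m + 1)) :
    ((uniformInfiniteTree ω).raise x).HitsAlong C (m + 1) := by
  rw [← zero_add (x : ℤ), gwTree_add] at h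
  obtain ⟨hroot, i, hi, havoid, hhits⟩ := LabeledTree.hitsAlong_succ.1 h
  have hsubtree {j : ℕ} (hj : j ≤ i) : ((uniformInfiniteTree ω).raise x).subtree j
      = ((gwTree 0 (ω.2.1 0)).raise x).subtree j :=
    congrArg (LabeledTree.raise · x) (uniformInfiniteTree_subtree_left ω (hj.trans_lt hi))
  refine LabeledTree.hitsAlong_succ.2 ⟨hroot, i, Nat.lt_add_right _ (Nat.lt_add_right _ hi),
    fun j hj => ?_, ?_⟩
  · rw [hsubtree hj.le]
    exact havoid j hj
  · rwa [hsubtree le_rfl]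

theorem hitsAlong_of_spine {x : ℕ} {ω : Sample} {C : ℕ → Set ℕ} {m : ℕ}
    (hx : x ≠ 0) (hC : x ∈ C (m + 1)) (havoid : (gwTree x (ω.2.1 0)).Avoids 0)
    (h : ((uniformInfiniteTree (shift ω)).raise (x + ω.1 0)).HitsAlong C m) :
    ((uniformInfiniteTree ω).raise x).HitsAlong C (m + 1) := by
  refine LabeledTree.hitsAlong_succ.2 ⟨⟨x, hC, hx, zero_add _⟩, (ω.2.1 0 []).1,
    Nat.lt_add_right _ (Nat.lt_succ_self _), fun j hj => ?_, ?_⟩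
  · rw [← zero_add (x : ℤ), gwTree_add] at havoid
    have := (LabeledTree.avoids_iff.1 havoid).2 j hj
    rwa [show ((uniformInfiniteTree ω).raise x).subtree j = ((gwTree 0 (ω.2.1 0)).raise x).subtree j
      from congrArg (LabeledTree.raise · x) (uniformInfiniteTree_subtree_left ω hj)]
  · rw [add_comm, ← LabeledTree.raise_raise, ← uniformInfiniteTree_subtree_spine] at h
    exact h

/-! ### Measurability -/

/-- A random tree all of whose numbers of children and labels are measurable. -/
structure MeasurableTree {Ω : Type*} [MeasurableSpace Ω] (θ : Ω → LabeledTree) : Prop where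
  children : ∀ u, Measurable fun ω => (θ ω).children u
  label : ∀ u, Measurable fun ω => (θ ω).label u

namespace MeasurableTree

variable {Ω : Type*} [MeasurableSpace Ω] {θ : Ω → LabeledTree}

theorem isVertex (h : MeasurableTree θ) (u : List ℕ) :
    Measurable fun ω => (θ ω).IsVertex u := by
  refine Measurable.forall fun v => Measurable.forall fun i => measurable_const.imp ?_
  exact measurableSet_setOfPred.1 (measurableSet_lt measurable_const (h.children v))

theorem label_eq (h : MeasurableTree θ) (u : List ℕ) (y : ℤ) :
    Measurable fun ω => (θ ω).label u = y :=
  measurableSet_setOfPred.1 (h.label u (measurableSet_singleton y))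

theorem avoids (h : MeasurableTree θ) (y : ℤ) : Measurable fun ω => (θ ω).Avoids y :=
  Measurable.forall fun v => (h.isVertex v).imp (h.label_eq v y).not

theorem isFirstWithLabel (h : MeasurableTree θ) (y : ℤ) (u : List ℕ) :
    Measurable fun ω => (θ ω).IsFirstWithLabel y u :=
  (h.isVertex u).and <| (h.label_eq u y).and <|
    Measurable.forall fun v => (h.isVertex v).imp (measurable_const.imp (h.label_eq v y).not)

theorem hitsAlong (h : MeasurableTree θ) (C : ℕ → Set ℕ) (m : ℕ) :
    Measurable fun ω => (θ ω).HitsAlong C m :=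
  Measurable.exists fun u => (h.isFirstWithLabel 0 u).and <| measurable_const.and <|
    Measurable.forall fun _ => measurable_const.imp <|
      Measurable.exists fun a => measurable_const.and (h.label_eq _ a)

theorem branchLabel (h : MeasurableTree θ) (k i : ℕ) :
    Measurable fun ω => (θ ω).branchLabel k i := by
  refine measurable_to_countable' fun z => ?_
  have hfirstHit (u : List ℕ) : Measurable fun ω => (θ ω).firstHit k = u := by
    simp only [LabeledTree.firstHit_eq_iff]
    exact (h.isFirstWithLabel _ u).or
      (measurable_const.and (Measurable.forall fun v => (h.isFirstWithLabel _ v).not))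
  have hpreimage : (fun ω => (θ ω).branchLabel k i) ⁻¹' {z} =
      {ω | ∃ u, (θ ω).firstHit k = u ∧ (θ ω).label (List.dropLast^[i] u) = z - k} := by
    ext ω
    simp [LabeledTree.branchLabel, LabeledTree.branch, eq_sub_iff_add_eq]
  rw [hpreimage]
  exact measurableSet_setOfPred.2
    (Measurable.exists fun u => (hfirstHit u).and (h.label_eq _ _))

theorem raise (h : MeasurableTree θ) {ξ : Ω → ℤ} (hξ : Measurable ξ) :
    MeasurableTree fun ω => (θ ω).raise (ξ ω) where
  children := h.children
  label u := (h.label u).add hξ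

theorem comp (h : MeasurableTree θ) {Ω' : Type*} [MeasurableSpace Ω'] {φ : Ω' → Ω}
    (hφ : Measurable φ) : MeasurableTree fun ω => θ (φ ω) where
  children u := (h.children u).comp hφ
  label u := (h.label u).comp hφ

end MeasurableTree

theorem measurableTree_gwTree (x : ℤ) : MeasurableTree (gwTree x) where
  children u := measurable_fst.comp (measurable_pi_apply u)
  label u := by
    suffices h : Measurable fun p : GWField × ℤ => gwLabel p.1 p.2 u from
      h.comp (measurable_id.prodMk measurable_const)
    induction u with
    | nil => exact measurable_snd
    | cons i u ih =>
      exact ih.comp (f := fun p : GWField × ℤ => (fun v => p.1 (i :: v), p.2 + (p.1 [i]).2))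
        (by fun_prop)

theorem measurable_ite_lt_ite_eq {Ω β : Type*} [MeasurableSpace Ω] [MeasurableSpace β] (i : ℕ)
    {n : Ω → ℕ} {f g : Ω → β} {h : ℕ → Ω → β} (hn : Measurable n) (hf : Measurable f)
    (hg : Measurable g) (hh : ∀ j, Measurable (h j)) :
    Measurable fun ω =>
      if i < n ω then f ω else if i = n ω then g ω else h (i - (n ω + 1)) ω := by
  have huncurry : Measurable fun p : Ω × ℕ => h p.2 p.1 := measurable_from_prod_countable_left hh
  refine Measurable.ite (measurableSet_lt measurable_const hn) hf
    (Measurable.ite (measurableSet_eq_fun measurable_const hn) hg ?_)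
  exact huncurry.comp (measurable_id.prodMk
    ((Measurable.of_discrete (f := fun n => i - (n + 1))).comp hn))

theorem measurableTree_graft {Ω : Type*} [MeasurableSpace Ω] {L R : Ω → ℕ → LabeledTree}
    (hL : ∀ j, MeasurableTree fun ω => L ω j) (hR : ∀ j, MeasurableTree fun ω => R ω j) :
    MeasurableTree fun ω => graft (L ω) (R ω) where
  children u := by
    suffices h : ∀ j, Measurable fun ω => graftChildren (L ω) (R ω) j u from h 0
    induction u with
    | nil => exact fun j => (((hL j).children []).add_const 1).add ((hR j).children [])
    | cons i u ih =>
      exact fun j => measurable_ite_lt_ite_eq i ((hL j).children []) ((hL j).children _) (ih _)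
        fun n => (hR j).children (n :: u)
  label u := by
    suffices h : ∀ j, Measurable fun ω => graftLabel (L ω) (R ω) j u from h 0
    induction u with
    | nil => exact fun j => (hL j).label []
    | cons i u ih =>
      exact fun j => measurable_ite_lt_ite_eq i ((hL j).children []) ((hL j).label _) (ih _)
        fun n => (hR j).label (n :: u)

theorem measurableTree_uniformInfiniteTree : MeasurableTree uniformInfiniteTree := by
  have hspine (j : ℕ) : Measurable fun ω => spineLabel ω j := by
    unfold spineLabel
    fun_prop
  have hgw {φ : Sample → GWField} (hφ : Measurable φ) (j : ℕ) :
      MeasurableTree fun ω => gwTree (spineLabel ω j) (φ ω) := by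
    simpa only [← gwTree_add, zero_add] using
      ((measurableTree_gwTree 0).comp hφ).raise (hspine j)
  exact measurableTree_graft (fun j => hgw (by fun_prop) j) fun j => hgw (by fun_prop) j

theorem measurable_firstLabels (r k : ℕ) : Measurable (firstLabels r k) :=
  measurable_pi_lambda _ fun i => (Measurable.of_discrete (f := fun z : ℤ => (z : ℝ))).comp
    (measurableTree_uniformInfiniteTree.branchLabel k (i + 1))

/-! ### Splitting off the root -/

theorem measurePreserving_eval_prodMk_comp {ι κ X : Type*} [MeasurableSpace X] (μ : Measure X)
    [IsProbabilityMeasure μ] {i₀ : ι} {e : κ → ι} (he : Function.Injective e)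
    (hne : ∀ k, e k ≠ i₀) :
    MeasurePreserving (fun f : ι → X => (f i₀, fun k => f (e k)))
      (Measure.infinitePi fun _ => μ) (μ.prod (Measure.infinitePi fun _ => μ)) := by
  have hhead : Measurable fun f : ι → X => f i₀ := measurable_pi_apply i₀
  have htail : Measurable fun (f : ι → X) k => f (e k) := by fun_prop
  refine ⟨hhead.prodMk htail, ?_⟩
  have hcoord : iIndepFun (fun i (f : ι → X) => f i) (Measure.infinitePi fun _ => μ) :=
    iIndepFun_infinitePi (X := fun _ x => x) fun _ => measurable_id
  have hsplit := indep_iSup_of_disjoint (fun i => (measurable_pi_apply i).comap_le) hcoord.iIndep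
    (S := {i₀}) (T := Set.range e) (by simpa using hne)
  have hindep : IndepFun (fun f : ι → X => f i₀) (fun f k => f (e k))
      (Measure.infinitePi fun _ => μ) := by
    refine indep_of_indep_of_le_left (indep_of_indep_of_le_right hsplit ?_) (by simp)
    rw [MeasurableSpace.pi, MeasurableSpace.comap_iSup, iSup_range]
    exact iSup_mono fun k => MeasurableSpace.comap_comp.le
  rw [hindep.map_prod_eq_prod_map_map hhead.aemeasurable htail.aemeasurable,
    Measure.infinitePi_map_eval, Measure.map_infinitePi_infinitePi_of_inj he]

theorem measurePreserving_gwField_root :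
    MeasurePreserving (fun g : GWField => ((g []).2, ((g []).1, fun i v => g (i :: v))))
      gwFieldLaw
      (stepLaw.prod (offspringLaw.prod (Measure.infinitePi fun _ : ℕ => gwFieldLaw))) := by
  have hroot := measurePreserving_eval_prodMk_comp (offspringLaw.prod stepLaw)
    (i₀ := ([] : List ℕ)) (e := fun p : ℕ × List ℕ => p.1 :: p.2)
    (fun p q h => Prod.ext (List.cons.inj h).1 (List.cons.inj h).2) fun _ => List.cons_ne_nil _ _
  have hcurry : MeasurePreserving (MeasurableEquiv.curry ℕ (List ℕ) (ℕ × ℤ))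
      (Measure.infinitePi fun _ => offspringLaw.prod stepLaw)
      (Measure.infinitePi fun _ => gwFieldLaw) :=
    ⟨MeasurableEquiv.measurable _,
      Measure.infinitePi_map_curry fun _ _ => offspringLaw.prod stepLaw⟩
  exact (measurePreserving_prodAssoc _ _ _).comp
    ((Measure.measurePreserving_swap.prod hcurry).comp hroot)

theorem measurePreserving_sample_root :
    MeasurePreserving (fun ω : Sample => (ω.2.1 0, ω.1 0, shift ω)) sampleLaw
      (gwFieldLaw.prod (stepLaw.prod sampleLaw)) := by
  have hhead {X : Type} [MeasurableSpace X] (μ : Measure X) [IsProbabilityMeasure μ] :=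
    measurePreserving_eval_prodMk_comp μ (i₀ := 0) Nat.succ_injective Nat.succ_ne_zero
  have htail := measurePreserving_snd.comp (hhead gwFieldLaw)
  have hsplit := (hhead stepLaw).prod
    ((measurePreserving_prodAssoc _ _ _).comp ((hhead gwFieldLaw).prod htail))
  exact (((MeasurePreserving.id gwFieldLaw).prod ((measurePreserving_prodAssoc _ _ _).comp
    Measure.measurePreserving_swap)).comp ((measurePreserving_prodAssoc _ _ _).comp
      Measure.measurePreserving_swap)).comp hsplit

/-! ### Offspring and step laws -/

theorem offspringLaw_singleton (n : ℕ) : offspringLaw {n} = 2⁻¹ ^ (n + 1) := by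
  have hweight : (1 - 1 / 2 : ℝ) ^ n * (1 / 2) = 2⁻¹ ^ (n + 1) := by ring
  rw [offspringLaw, geometricMeasure_singleton
    (by simp only [ne_eq, ← Subtype.val_inj]; norm_num), hweight,
    ENNReal.ofReal_pow (by norm_num), ENNReal.ofReal_inv_of_pos (by norm_num), ENNReal.ofReal_ofNat]

theorem offspringLaw_Ioi (n : ℕ) : offspringLaw (Set.Ioi n) = 2⁻¹ ^ (n + 1) := by
  induction n with
  | zero =>
    have hIoi : Set.Ioi 0 = ({0} : Set ℕ)ᶜ := by ext; simp [Nat.pos_iff_ne_zero]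
    rw [hIoi, prob_compl_eq_one_sub (measurableSet_singleton 0), offspringLaw_singleton, zero_add,
      pow_one, ENNReal.one_sub_inv_two]
  | succ n ih =>
    have hIoi : Set.Ioi (n + 1) = Set.Ioi n \ {n + 1} := by
      ext
      simp only [Set.mem_Ioi, Set.mem_sdiff, Set.mem_singleton_iff]
      lia
    have hhalf : (2⁻¹ : ℝ≥0∞) ^ (n + 1) = 2⁻¹ ^ (n + 1 + 1) + 2⁻¹ ^ (n + 1 + 1) := by
      rw [pow_succ _ (n + 1), ← mul_add, ENNReal.inv_two_add_inv_two, mul_one]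
    rw [hIoi, measure_sdiff (by simp) (measurableSet_singleton _).nullMeasurableSet
      (measure_ne_top _ _), ih, offspringLaw_singleton, hhalf,
      ENNReal.add_sub_cancel_right (ENNReal.pow_ne_top (by simp))]

theorem tsum_geometric_half_mul (a : ℝ≥0∞) :
    ∑' n : ℕ, 2⁻¹ ^ (n + 1) * a ^ n = (2 - a)⁻¹ := by
  have hratio : 2 * (1 - 2⁻¹ * a) = 2 - a := by
    rw [ENNReal.mul_sub (by simp), mul_one, ← mul_assoc,
      ENNReal.mul_inv_cancel two_ne_zero ENNReal.ofNat_ne_top, one_mul]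
  calc ∑' n : ℕ, 2⁻¹ ^ (n + 1) * a ^ n = ∑' n : ℕ, 2⁻¹ * (2⁻¹ * a) ^ n := by
        congr! 2 with n
        ring
    _ = (2 - a)⁻¹ := by
        rw [ENNReal.tsum_mul_left, ENNReal.tsum_geometric,
          ← ENNReal.mul_inv (by simp) (by simp), hratio]

section Siblings

variable {X : Type*} [MeasurableSpace X] (ν : Measure X) [IsProbabilityMeasure ν] {A H : Set X}

theorem infinitePi_forall_lt_mem (hA : MeasurableSet A) (n : ℕ) :
    Measure.infinitePi (fun _ : ℕ => ν) {h | ∀ i < n, h i ∈ A} = ν A ^ n := by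
  have hpi : {h : ℕ → X | ∀ i < n, h i ∈ A} = Set.pi (Finset.range n) fun _ => A := by
    ext; simp
  rw [hpi, Measure.infinitePi_pi _ fun _ _ => hA, Finset.prod_const, Finset.card_range]

theorem infinitePi_forall_lt_mem_and_mem (hA : MeasurableSet A) (hH : MeasurableSet H) (n : ℕ) :
    Measure.infinitePi (fun _ : ℕ => ν) {h | (∀ i < n, h i ∈ A) ∧ h n ∈ H} = ν A ^ n * ν H := by
  classical
  have hpi : {h : ℕ → X | (∀ i < n, h i ∈ A) ∧ h n ∈ H} =
      Set.pi (Finset.range (n + 1)) fun i => if i = n then H else A := by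
    ext h
    simp only [Set.mem_ofPred_eq, Set.mem_pi, Finset.coe_range, Set.mem_Iio,
      Nat.forall_lt_succ_right, if_true]
    congr! 3 with i hi
    simp [hi.ne]
  rw [hpi, Measure.infinitePi_pi _ fun i _ => by split_ifs <;> assumption,
    Finset.prod_range_succ, if_pos rfl]
  congr 1
  rw [Finset.prod_congr rfl fun i hi => by rw [if_neg (Finset.mem_range.1 hi).ne],
    Finset.prod_const, Finset.card_range]

theorem measurableSet_offspring_forall_mem (hA : MeasurableSet A) :
    MeasurableSet {q : ℕ × (ℕ → X) | ∀ i < q.1, q.2 i ∈ A} := by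
  refine measurableSet_setOfPred.2 (Measurable.forall fun i => Measurable.imp ?_ ?_)
  · exact measurableSet_setOfPred.1 (measurableSet_lt measurable_const measurable_fst)
  · exact measurableSet_setOfPred.1 (hA.preimage (by fun_prop))

theorem measurableSet_offspring_exists_first_mem (hA : MeasurableSet A) (hH : MeasurableSet H) :
    MeasurableSet {q : ℕ × (ℕ → X) | ∃ i < q.1, (∀ j < i, q.2 j ∈ A) ∧ q.2 i ∈ H} := by
  refine measurableSet_setOfPred.2 (Measurable.exists fun i => Measurable.and ?_
    (Measurable.and (Measurable.forall fun j => measurable_const.imp ?_) ?_))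
  · exact measurableSet_setOfPred.1 (measurableSet_lt measurable_const measurable_fst)
  · exact measurableSet_setOfPred.1 (hA.preimage (by fun_prop))
  · exact measurableSet_setOfPred.1 (hH.preimage (by fun_prop))

theorem offspring_forall_mem (hA : MeasurableSet A) :
    offspringLaw.prod (Measure.infinitePi fun _ : ℕ => ν) {q | ∀ i < q.1, q.2 i ∈ A} =
      (2 - ν A)⁻¹ := by
  rw [Measure.prod_apply (measurableSet_offspring_forall_mem hA), lintegral_countable',
    ← tsum_geometric_half_mul]
  congr! 2 with n
  rw [offspringLaw_singleton, mul_comm, ← infinitePi_forall_lt_mem ν hA]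
  rfl

theorem offspring_exists_first_mem (hA : MeasurableSet A) (hH : MeasurableSet H)
    (hdisj : Disjoint A H) :
    offspringLaw.prod (Measure.infinitePi fun _ : ℕ => ν)
      {q | ∃ i < q.1, (∀ j < i, q.2 j ∈ A) ∧ q.2 i ∈ H} = (2 - ν A)⁻¹ * ν H := by
  set E : ℕ → Set (ℕ → X) := fun i => {h | (∀ j < i, h j ∈ A) ∧ h i ∈ H}
  have hunion : {q : ℕ × (ℕ → X) | ∃ i < q.1, (∀ j < i, q.2 j ∈ A) ∧ q.2 i ∈ H} =
      ⋃ i, Set.Ioi i ×ˢ E i := by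
    ext; simp [E]
  have hE (i : ℕ) : MeasurableSet (E i) :=
    measurableSet_setOfPred.2 <| Measurable.and
      (Measurable.forall fun j => measurable_const.imp
        (measurableSet_setOfPred.1 (hA.preimage (measurable_pi_apply j))))
      (measurableSet_setOfPred.1 (hH.preimage (measurable_pi_apply i)))
  have hEdisj : Pairwise (Function.onFun Disjoint fun i => Set.Ioi i ×ˢ E i) := by
    refine (pairwise_disjoint_on _).2 fun i j hij => Set.disjoint_left.2 fun q hi hj => ?_
    exact Set.disjoint_left.1 hdisj (hj.2.1 i hij) hi.2.2
  rw [hunion, measure_iUnion hEdisj fun i => measurableSet_Ioi.prod (hE i),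
    ← tsum_geometric_half_mul, ← ENNReal.tsum_mul_right]
  congr! 2 with i
  rw [Measure.prod_prod, offspringLaw_Ioi, infinitePi_forall_lt_mem_and_mem ν hA hH, mul_assoc]

end Siblings

theorem lintegral_stepLaw (f : ℤ → ℝ≥0∞) :
    ∫⁻ d, f d ∂stepLaw = 3⁻¹ * (f (-1) + f 0 + f 1) := by
  have hsingleton (d : ℤ) : stepLaw {d} = if d ∈ ({-1, 0, 1} : Finset ℤ) then 3⁻¹ else 0 := by
    rw [stepLaw, PMF.toMeasure_apply_singleton _ _ (measurableSet_singleton d),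
      PMF.uniformOfFinset_apply]
    congr
  rw [lintegral_countable', tsum_eq_sum (s := ({-1, 0, 1} : Finset ℤ))
    fun d hd => by rw [hsingleton, if_neg hd, mul_zero]]
  simp only [hsingleton, Finset.sum_ite_mem, Finset.inter_self, mul_ite, mul_zero]
  rw [← Finset.sum_mul, mul_comm, Finset.sum_insert (by decide), Finset.sum_insert (by decide),
    Finset.sum_singleton, add_assoc]

/-! ### Probabilities of hitting zero along a prescribed branch -/

/-- The average of `f` over `x` and its two neighbours, for `x ≠ 0`: one step of the label walk. -/
def avg (f : ℕ → ℝ≥0∞) (x : ℕ) : ℝ≥0∞ := 3⁻¹ * (f (x - 1) + f x + f (x + 1))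

/-- The probability that a labeled Galton-Watson tree with root label `x` has no label `0`. -/
def avoidProb (x : ℕ) : ℝ≥0∞ := gwFieldLaw {g | (gwTree x g).Avoids 0}

/-- The one-step operator of the walk with uniform increments on `{-1, 0, 1}`, weighted by the
probability that the tree to the left of the branch avoids `0`. It vanishes at `0`. -/
def transfer : (ℕ → ℝ≥0∞) →ₗ[ℝ≥0∞] (ℕ → ℝ≥0∞) where
  toFun f x := avoidProb x * avg f x
  map_add' f g := by
    funext x
    simp only [avg, Pi.add_apply]
    ring
  map_smul' c f := by
    funext x
    simp only [avg, Pi.smul_apply, smul_eq_mul, RingHom.id_apply]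
    ring

theorem transfer_apply (f : ℕ → ℝ≥0∞) (x : ℕ) : transfer f x = avoidProb x * avg f x := rfl

/-- The total weight of the walks of length `m` from `x` to `0` which are in `C i` at time `m - i`,
and hence first reach `0` at time `m`. -/
def pathWeight (C : ℕ → Set ℕ) : ℕ → ℕ → ℝ≥0∞
  | 0 => (C 0).indicator (Pi.single 0 1)
  | m + 1 => (C (m + 1)).indicator (transfer (pathWeight C m))

theorem lintegral_stepLaw_add {x : ℕ} (hx : x ≠ 0) (F : ℤ → ℝ≥0∞) :
    ∫⁻ d, F (x + d) ∂stepLaw = avg (fun a => F a) x := by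
  obtain ⟨n, rfl⟩ := Nat.exists_eq_succ_of_ne_zero hx
  simp [lintegral_stepLaw, avg]

theorem measurableTree_gwTree_increment (x : ℤ) :
    MeasurableTree fun g => gwTree (x + (g []).2) g := by
  simpa only [gwTree_add] using (measurableTree_gwTree x).raise (ξ := fun g => (g []).2)
    (by fun_prop)

theorem gwFieldLaw_children {S : Set (ℕ × (ℕ → GWField))} (hS : MeasurableSet S) :
    gwFieldLaw {g | ((g []).1, fun i v => g (i :: v)) ∈ S} =
      offspringLaw.prod (Measure.infinitePi fun _ => gwFieldLaw) S :=
  (measurePreserving_snd.comp measurePreserving_gwField_root).measure_preimage hS.nullMeasurableSet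

theorem exists_measurable_gwTree_eq : ∃ join : ℕ × (ℕ → GWField) → GWField, Measurable join ∧
    ∀ z g, gwTree z g = gwTree z (join ((g []).1, fun i v => g (i :: v))) := by
  refine ⟨fun q u => match u with
    | [] => (q.1, 0)
    | i :: v => q.2 i v, measurable_pi_lambda _ fun u => ?_, fun z g => ?_⟩
  · cases u <;> fun_prop
  · refine congrArg₂ LabeledTree.mk ?_ ?_ <;> funext u <;> cases u <;> rfl

theorem gwFieldLaw_increment {p : LabeledTree → Prop}
    (hp : ∀ z, Measurable fun g => p (gwTree z g)) (x : ℤ) :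
    gwFieldLaw {g | p (gwTree (x + (g []).2) g)} =
      ∫⁻ d, gwFieldLaw {g | p (gwTree (x + d) g)} ∂stepLaw := by
  obtain ⟨join, hjoin, hgwTree⟩ := exists_measurable_gwTree_eq
  let E : ℤ → Set (ℕ × (ℕ → GWField)) := fun d => {q | p (gwTree (x + d) (join q))}
  have hE (d : ℤ) : MeasurableSet (E d) := measurableSet_setOfPred.2 ((hp _).comp hjoin)
  have hE' : MeasurableSet {q : ℤ × ℕ × (ℕ → GWField) | q.2 ∈ E q.1} := measurableSet_setOfPred.2 <|
    measurable_from_prod_countable_right fun d => measurableSet_setOfPred.1 (hE d)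
  calc gwFieldLaw {g | p (gwTree (x + (g []).2) g)}
      = stepLaw.prod (offspringLaw.prod (Measure.infinitePi fun _ => gwFieldLaw))
          {q | q.2 ∈ E q.1} := by
        rw [← measurePreserving_gwField_root.measure_preimage hE'.nullMeasurableSet]
        exact congrArg gwFieldLaw (Set.ext fun g => iff_of_eq (congrArg p (hgwTree _ g)))
    _ = ∫⁻ d, gwFieldLaw {g | p (gwTree (x + d) g)} ∂stepLaw := by
        rw [Measure.prod_apply hE']
        refine lintegral_congr fun d => (gwFieldLaw_children (hE d)).symm.trans ?_
        exact congrArg gwFieldLaw (Set.ext fun g => iff_of_eq (congrArg p (hgwTree _ g).symm))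

theorem gwFieldLaw_avoids_increment {x : ℕ} (hx : x ≠ 0) :
    gwFieldLaw {g | (gwTree (x + (g []).2) g).Avoids 0} = avg avoidProb x := by
  rw [gwFieldLaw_increment (p := (LabeledTree.Avoids · 0))
    fun z => (measurableTree_gwTree z).avoids 0]
  exact lintegral_stepLaw_add hx fun z => gwFieldLaw {g | (gwTree z g).Avoids 0}

theorem gwFieldLaw_hitsAlong_increment (C : ℕ → Set ℕ) (m : ℕ) {x : ℕ} (hx : x ≠ 0) :
    gwFieldLaw {g | (gwTree (x + (g []).2) g).HitsAlong C m} =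
      avg (fun a => gwFieldLaw {g | (gwTree a g).HitsAlong C m}) x := by
  rw [gwFieldLaw_increment (p := (LabeledTree.HitsAlong · C m))
    fun z => (measurableTree_gwTree z).hitsAlong C m]
  exact lintegral_stepLaw_add hx fun z => gwFieldLaw {g | (gwTree z g).HitsAlong C m}

theorem avoidProb_zero : avoidProb 0 = 0 := by
  have hempty : {g | (gwTree (0 : ℕ) g).Avoids 0} = ∅ := Set.eq_empty_of_forall_notMem
    fun g hg => (LabeledTree.avoids_iff.1 hg).1 rfl
  rw [avoidProb, hempty, measure_empty]

theorem avoidProb_eq_inv {x : ℕ} (hx : x ≠ 0) : avoidProb x = (2 - avg avoidProb x)⁻¹ := by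
  set A : Set GWField := {g | (gwTree (x + (g []).2) g).Avoids 0}
  have hA : MeasurableSet A := measurableSet_setOfPred.2
    ((measurableTree_gwTree_increment x).avoids 0)
  have hchildren (g : GWField) :
      (gwTree x g).Avoids 0 ↔ ∀ i < (g []).1, (fun v => g (i :: v)) ∈ A :=
    LabeledTree.avoids_iff.trans (and_iff_right (Int.natCast_ne_zero.2 hx))
  calc avoidProb x = gwFieldLaw {g | ∀ i < (g []).1, (fun v => g (i :: v)) ∈ A} := by
        simp only [avoidProb, hchildren]
    _ = (2 - gwFieldLaw A)⁻¹ :=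
        (gwFieldLaw_children (measurableSet_offspring_forall_mem hA)).trans
          (offspring_forall_mem gwFieldLaw hA)
    _ = (2 - avg avoidProb x)⁻¹ := by rw [gwFieldLaw_avoids_increment hx]

theorem gwFieldLaw_hitsAlong_succ (C : ℕ → Set ℕ) (m : ℕ) {x : ℕ} (hx : x ≠ 0)
    (hC : x ∈ C (m + 1)) :
    gwFieldLaw {g | (gwTree x g).HitsAlong C (m + 1)} =
      transfer (fun a => gwFieldLaw {g | (gwTree a g).HitsAlong C m}) x := by
  set A : Set GWField := {g | (gwTree (x + (g []).2) g).Avoids 0}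
  set H : Set GWField := {g | (gwTree (x + (g []).2) g).HitsAlong C m}
  have hA : MeasurableSet A := measurableSet_setOfPred.2
    ((measurableTree_gwTree_increment x).avoids 0)
  have hH : MeasurableSet H := measurableSet_setOfPred.2
    ((measurableTree_gwTree_increment x).hitsAlong C m)
  have hdisj : Disjoint A H := Set.disjoint_left.2 fun g hgA hgH => hgH.not_avoids hgA
  have hchildren (g : GWField) : (gwTree x g).HitsAlong C (m + 1) ↔
      ∃ i < (g []).1, (∀ j < i, (fun v => g (j :: v)) ∈ A) ∧ (fun v => g (i :: v)) ∈ H :=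
    LabeledTree.hitsAlong_succ.trans (and_iff_right ⟨x, hC, hx, rfl⟩)
  calc gwFieldLaw {g | (gwTree x g).HitsAlong C (m + 1)}
      = gwFieldLaw {g | ∃ i < (g []).1,
          (∀ j < i, (fun v => g (j :: v)) ∈ A) ∧ (fun v => g (i :: v)) ∈ H} := by
        simp only [hchildren]
    _ = (2 - gwFieldLaw A)⁻¹ * gwFieldLaw H :=
        (gwFieldLaw_children (measurableSet_offspring_exists_first_mem hA hH)).trans
          (offspring_exists_first_mem gwFieldLaw hA hH hdisj)
    _ = transfer (fun a => gwFieldLaw {g | (gwTree a g).HitsAlong C m}) x := by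
        rw [gwFieldLaw_avoids_increment hx, ← avoidProb_eq_inv hx,
          gwFieldLaw_hitsAlong_increment C m hx, transfer_apply]

theorem transfer_zero_right (f : ℕ → ℝ≥0∞) : transfer f 0 = 0 := by
  rw [transfer_apply, avoidProb_zero, zero_mul]

open Classical in
theorem pathWeight_zero_apply (C : ℕ → Set ℕ) (x : ℕ) :
    pathWeight C 0 x = if x = 0 ∧ 0 ∈ C 0 then 1 else 0 := by
  rcases eq_or_ne x 0 with rfl | hx
  · simp [pathWeight, Set.indicator_apply]
  · simp [pathWeight, Set.indicator_apply, hx]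

theorem pathWeight_succ_eq_zero {C : ℕ → Set ℕ} {m x : ℕ} (h : ¬ (x ≠ 0 ∧ x ∈ C (m + 1))) :
    pathWeight C (m + 1) x = 0 := by
  rw [pathWeight, Set.indicator_apply_eq_zero]
  intro hC
  obtain rfl : x = 0 := by
    by_contra hx
    exact h ⟨hx, hC⟩
  exact transfer_zero_right _

theorem gwFieldLaw_hitsAlong (C : ℕ → Set ℕ) (m x : ℕ) :
    gwFieldLaw {g | (gwTree x g).HitsAlong C m} = pathWeight C m x := by
  induction m generalizing x with
  | zero =>
    have hroot (g : GWField) : (gwTree x g).HitsAlong C 0 ↔ x = 0 ∧ 0 ∈ C 0 :=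
      LabeledTree.hitsAlong_zero.trans (and_congr_left' Int.natCast_eq_zero)
    simp only [hroot, pathWeight_zero_apply]
    split_ifs with h <;> simp [h]
  | succ m ih =>
    by_cases h : x ≠ 0 ∧ x ∈ C (m + 1)
    · rw [gwFieldLaw_hitsAlong_succ C m h.1 h.2]
      simp only [ih, pathWeight, Set.indicator_of_mem h.2]
    · have hempty : {g | (gwTree x g).HitsAlong C (m + 1)} = ∅ := by
        refine Set.eq_empty_of_forall_notMem fun g hg => h ?_
        obtain ⟨⟨a, haC, ha, hroot⟩, -⟩ := LabeledTree.hitsAlong_succ.1 hg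
        obtain rfl : x = a := Int.natCast_inj.1 hroot
        exact ⟨ha, haC⟩
      rw [hempty, measure_empty, pathWeight_succ_eq_zero h]

theorem transfer_mono {f g : ℕ → ℝ≥0∞} (h : f ≤ g) : transfer f ≤ transfer g := fun x => by
  simp only [transfer_apply, avg]
  gcongr <;> exact h _

theorem pathWeight_add_transfer_le (C : ℕ → Set ℕ) (m : ℕ) {x : ℕ} (hx : x ≠ 0)
    (hC : x ∈ C (m + 1)) :
    pathWeight C (m + 1) x +
        transfer (fun a => sampleLaw {ω | ((uniformInfiniteTree ω).raise a).HitsAlong C m}) x ≤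
      sampleLaw {ω | ((uniformInfiniteTree ω).raise x).HitsAlong C (m + 1)} := by
  set H : Set GWField := {g | (gwTree x g).HitsAlong C (m + 1)}
  set A : Set GWField := {g | (gwTree x g).Avoids 0}
  set S : Set (ℤ × Sample) :=
    {q | ((uniformInfiniteTree q.2).raise (x + q.1)).HitsAlong C m}
  have hH : MeasurableSet H := measurableSet_setOfPred.2 ((measurableTree_gwTree x).hitsAlong C _)
  have hA : MeasurableSet A := measurableSet_setOfPred.2 ((measurableTree_gwTree x).avoids 0)
  have hS : MeasurableSet S := measurableSet_setOfPred.2 <|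
    ((measurableTree_uniformInfiniteTree.comp measurable_snd).raise
      (measurable_fst.const_add _)).hitsAlong C m
  have hdisj : Disjoint (H ×ˢ Set.univ) (A ×ˢ S) :=
    Set.disjoint_left.2 fun q hqH hqA => hqH.1.not_avoids hqA.1
  have hleft : (gwFieldLaw.prod (stepLaw.prod sampleLaw)) (H ×ˢ Set.univ) =
      pathWeight C (m + 1) x := by
    rw [Measure.prod_prod, measure_univ, mul_one, gwFieldLaw_hitsAlong]
  have hspine : (gwFieldLaw.prod (stepLaw.prod sampleLaw)) (A ×ˢ S) =
      transfer (fun a => sampleLaw {ω | ((uniformInfiniteTree ω).raise a).HitsAlong C m}) x := by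
    rw [Measure.prod_prod, Measure.prod_apply hS, transfer_apply, ← lintegral_stepLaw_add hx
      fun z => sampleLaw {ω | ((uniformInfiniteTree ω).raise z).HitsAlong C m}]
    rfl
  rw [← hleft, ← hspine, ← measure_union hdisj (hA.prod hS),
    ← measurePreserving_sample_root.measure_preimage
      ((hH.prod .univ).union (hA.prod hS)).nullMeasurableSet]
  refine measure_mono ?_
  rintro ω (⟨hω, -⟩ | ⟨havoid, hω⟩)
  · exact hitsAlong_of_left hω
  · exact hitsAlong_of_spine hx hC havoid hω

theorem succ_mul_pathWeight_le (C : ℕ → Set ℕ) (m x : ℕ) :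
    (m + 1) * pathWeight C m x ≤
      sampleLaw {ω | ((uniformInfiniteTree ω).raise x).HitsAlong C m} := by
  induction m generalizing x with
  | zero =>
    have hroot (ω : Sample) : ((uniformInfiniteTree ω).raise x).HitsAlong C 0 ↔ x = 0 ∧ 0 ∈ C 0 :=
      LabeledTree.hitsAlong_zero.trans <| and_congr_left' <| by
        rw [show ((uniformInfiniteTree ω).raise x).label [] = x from zero_add _,
          Int.natCast_eq_zero]
    simp only [hroot, pathWeight_zero_apply]
    split_ifs with h <;> simp [h]
  | succ m ih =>
    by_cases h : x ≠ 0 ∧ x ∈ C (m + 1)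
    · have hpath : pathWeight C (m + 1) x = transfer (pathWeight C m) x :=
        Set.indicator_of_mem h.2 _
      calc ((m + 1 : ℕ) + 1) * pathWeight C (m + 1) x
          = pathWeight C (m + 1) x + transfer (fun a => (m + 1) * pathWeight C m a) x := by
            rw [hpath]
            simp only [transfer_apply, avg]
            push_cast
            ring
        _ ≤ pathWeight C (m + 1) x + transfer
              (fun a => sampleLaw {ω | ((uniformInfiniteTree ω).raise a).HitsAlong C m}) x := by
            gcongr
            exact transfer_mono ih x
        _ ≤ _ := pathWeight_add_transfer_le C m h.1 h.2
    · rw [pathWeight_succ_eq_zero h, mul_zero]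
      exact zero_le

/-! ### The probability of avoiding zero -/

theorem nonpos_of_convex_of_bddAbove {d c : ℕ → ℝ} (h0 : d 0 = 0) (hc : ∀ x, 0 ≤ c x)
    (hrec : ∀ x, d (x + 2) = 2 * d (x + 1) - d x + c x * d (x + 1))
    (hd : BddAbove (Set.range d)) : d 1 ≤ 0 := by
  obtain ⟨M, hM⟩ := hd
  by_contra! h1
  have hgrowth (x : ℕ) : x * d 1 ≤ d x ∧ d x + d 1 ≤ d (x + 1) := by
    induction x with
    | zero => simp [h0]
    | succ x ih =>
      have hnonneg : 0 ≤ d (x + 1) := by linarith [mul_nonneg x.cast_nonneg h1.le]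
      have hstep : d (x + 1 + 1) = 2 * d (x + 1) - d x + c x * d (x + 1) := hrec x
      push_cast
      constructor <;> linarith [mul_nonneg (hc x) hnonneg]
  obtain ⟨n, hn⟩ := exists_nat_gt (M / d 1)
  rw [div_lt_iff₀ h1] at hn
  linarith [hgrowth n, hM ⟨n, rfl⟩]

theorem eq_zero_of_convex_of_bounded {d c : ℕ → ℝ} {M : ℝ} (h0 : d 0 = 0) (hc : ∀ x, 0 ≤ c x)
    (hrec : ∀ x, d (x + 2) = 2 * d (x + 1) - d x + c x * d (x + 1)) (hd : ∀ x, |d x| ≤ M)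
    (x : ℕ) : d x = 0 := by
  have hle : d 1 ≤ 0 := nonpos_of_convex_of_bddAbove h0 hc hrec
    ⟨M, Set.forall_mem_range.2 fun x => (abs_le.1 (hd x)).2⟩
  have hge : -d 1 ≤ 0 := nonpos_of_convex_of_bddAbove (d := fun x => -d x) (by simp [h0]) hc
    (fun x => by simp only [hrec]; ring)
    ⟨M, Set.forall_mem_range.2 fun x => neg_le.2 (abs_le.1 (hd x)).1⟩
  suffices h : d x = 0 ∧ d (x + 1) = 0 from h.1
  induction x with
  | zero => exact ⟨h0, by linarith⟩
  | succ x ih => exact ⟨ih.2, by rw [hrec x, ih.1, ih.2]; ring⟩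

theorem eq_of_mul_two_sub_average_eq_one {V W : ℕ → ℝ} (hV0 : V 0 = 0) (hW0 : W 0 = 0)
    (hV : ∀ x, V x ∈ Set.Icc 0 1) (hW : ∀ x, W x ∈ Set.Icc 0 1)
    (hVrec : ∀ x, V (x + 1) * (2 - (V x + V (x + 1) + V (x + 2)) / 3) = 1)
    (hWrec : ∀ x, W (x + 1) * (2 - (W x + W (x + 1) + W (x + 2)) / 3) = 1) : V = W := by
  have hne {U : ℕ → ℝ} (hU : ∀ x, U (x + 1) * (2 - (U x + U (x + 1) + U (x + 2)) / 3) = 1)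
      (x : ℕ) : U (x + 1) ≠ 0 := left_ne_zero_of_mul_eq_one (hU x)
  have hnext {U : ℕ → ℝ} (hU : ∀ x, U (x + 1) * (2 - (U x + U (x + 1) + U (x + 2)) / 3) = 1)
      (x : ℕ) : U (x + 2) = 6 - 3 / U (x + 1) - U x - U (x + 1) := by
    have := hne hU x
    field_simp
    linarith [hU x]
  have hpos (x : ℕ) : 0 < V (x + 1) * W (x + 1) :=
    mul_pos ((hV _).1.lt_of_ne (hne hVrec x).symm) ((hW _).1.lt_of_ne (hne hWrec x).symm)
  funext x
  refine sub_eq_zero.1 (eq_zero_of_convex_of_bounded (d := fun x => V x - W x) (M := 1)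
    (c := fun x => 3 * (1 / (V (x + 1) * W (x + 1)) - 1)) (by simp [hV0, hW0])
    (fun x => ?_) (fun x => ?_) (fun x => abs_le.2 ⟨?_, ?_⟩) x)
  · have := one_le_one_div (hpos x) (mul_le_one₀ (hV _).2 (hW _).1 (hW _).2)
    linarith
  · have := hne hVrec x
    have := hne hWrec x
    simp only [hnext hVrec, hnext hWrec]
    field_simp
    ring
  · linarith [(hV x).1, (hW x).2]
  · linarith [(hV x).2, (hW x).1]

/-- The weight which `transfer` gives to each of the three steps from `x`: one third of the
probability that a labeled Galton-Watson tree with root label `x` has no label `0`. -/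
def stepWeight (x : ℕ) : ℝ := x * (x + 3) / (3 * (x + 1) * (x + 2))

theorem stepWeight_zero : stepWeight 0 = 0 := by simp [stepWeight]

theorem stepWeight_nonneg (x : ℕ) : 0 ≤ stepWeight x := by unfold stepWeight; positivity

theorem stepWeight_pos {x : ℕ} (hx : x ≠ 0) : 0 < stepWeight x := by unfold stepWeight; positivity

theorem one_sub_three_mul_stepWeight (x : ℕ) :
    1 - 3 * stepWeight x = 2 / ((x + 1) * (x + 2)) := by
  unfold stepWeight
  field_simp
  ring

theorem three_mul_stepWeight_mem_Icc (x : ℕ) : 3 * stepWeight x ∈ Set.Icc 0 1 := by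
  have : 0 ≤ 1 - 3 * stepWeight x := by rw [one_sub_three_mul_stepWeight]; positivity
  constructor <;> linarith [stepWeight_nonneg x]

theorem avoidProb_ne_top (x : ℕ) : avoidProb x ≠ ∞ := measure_ne_top _ _

theorem toReal_avoidProb_mem_Icc (x : ℕ) : (avoidProb x).toReal ∈ Set.Icc 0 1 :=
  ⟨ENNReal.toReal_nonneg, ENNReal.toReal_mono ENNReal.one_ne_top prob_le_one⟩

theorem toReal_avg {f : ℕ → ℝ≥0∞} (hf : ∀ x, f x ≠ ∞) (x : ℕ) :
    (avg f x).toReal = ((f (x - 1)).toReal + (f x).toReal + (f (x + 1)).toReal) / 3 := by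
  rw [avg, ENNReal.toReal_mul, ENNReal.toReal_add (by simp [hf]) (hf _),
    ENNReal.toReal_add (hf _) (hf _), ENNReal.toReal_inv, ENNReal.toReal_ofNat, inv_mul_eq_div]

theorem toReal_avoidProb_mul_two_sub (x : ℕ) : (avoidProb (x + 1)).toReal *
    (2 - ((avoidProb x).toReal + (avoidProb (x + 1)).toReal + (avoidProb (x + 2)).toReal) / 3) =
      1 := by
  have hreal := toReal_avg avoidProb_ne_top (x + 1)
  rw [Nat.add_sub_cancel] at hreal
  have havg : avg avoidProb (x + 1) ≠ ∞ :=
    ENNReal.mul_ne_top (by simp) (by simp [avoidProb_ne_top])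
  have hlt : (avg avoidProb (x + 1)).toReal < 2 := by
    rw [hreal]
    linarith [(toReal_avoidProb_mem_Icc x).2, (toReal_avoidProb_mem_Icc (x + 1)).2,
      (toReal_avoidProb_mem_Icc (x + 2)).2]
  have hle : avg avoidProb (x + 1) ≤ 2 := by
    rw [← ENNReal.toReal_le_toReal havg ENNReal.ofNat_ne_top]
    exact hlt.le
  have hinv : (avoidProb (x + 1)).toReal = (2 - (avg avoidProb (x + 1)).toReal)⁻¹ := by
    rw [avoidProb_eq_inv x.succ_ne_zero, ENNReal.toReal_inv,
      ENNReal.toReal_sub_of_le hle ENNReal.ofNat_ne_top, ENNReal.toReal_ofNat]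
  rw [← hreal, hinv]
  exact inv_mul_cancel₀ (sub_pos.2 hlt).ne'

theorem avoidProb_eq (x : ℕ) : avoidProb x = ENNReal.ofReal (3 * stepWeight x) := by
  have hunique : (fun x => (avoidProb x).toReal) = fun x => 3 * stepWeight x :=
    eq_of_mul_two_sub_average_eq_one (by simp [avoidProb_zero]) (by simp [stepWeight_zero])
      toReal_avoidProb_mem_Icc three_mul_stepWeight_mem_Icc toReal_avoidProb_mul_two_sub
      fun x => by
        simp only [stepWeight]
        push_cast
        field_simp
        ring
  rw [← congrFun hunique x, ENNReal.ofReal_toReal (avoidProb_ne_top x)]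

/-! ### The Green operator -/

theorem transfer_tsum (f : ℕ → ℕ → ℝ≥0∞) (x : ℕ) :
    transfer (fun a => ∑' n, f n a) x = ∑' n, transfer (f n) x := by
  simp only [transfer_apply, avg, ENNReal.tsum_mul_left, ENNReal.tsum_add]

/-- The Green operator `∑ n, transfer ^ n`. -/
def green : (ℕ → ℝ≥0∞) →ₗ[ℝ≥0∞] (ℕ → ℝ≥0∞) where
  toFun f x := ∑' n, (transfer ^ n) f x
  map_add' f g := funext fun x => by
    simp only [map_add, Pi.add_apply, ENNReal.tsum_add]
  map_smul' a f := funext fun x => by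
    simp only [map_smul, Pi.smul_apply, smul_eq_mul, ENNReal.tsum_mul_left, RingHom.id_apply]

theorem green_apply (f : ℕ → ℝ≥0∞) (x : ℕ) : green f x = ∑' n, (transfer ^ n) f x := rfl

theorem transfer_pow_green (f : ℕ → ℝ≥0∞) (n x : ℕ) :
    (transfer ^ n) (green f) x = ∑' m, (transfer ^ (n + m)) f x := by
  induction n generalizing x with
  | zero => simp only [pow_zero, Module.End.one_apply, zero_add, green_apply]
  | succ n ih =>
    simp only [add_right_comm n 1, pow_succ', Module.End.mul_apply, ← transfer_tsum]
    rw [funext ih]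

theorem green_eq_add_green_transfer (f : ℕ → ℝ≥0∞) : green f = f + green (transfer f) := by
  funext x
  rw [green_apply, tsum_eq_zero_add' ENNReal.summable]
  simp only [pow_succ, Module.End.mul_apply]
  rfl

theorem green_eq_add_transfer_green (f : ℕ → ℝ≥0∞) : green f = f + transfer (green f) := by
  funext x
  rw [Pi.add_apply, green_apply, tsum_eq_zero_add' ENNReal.summable]
  congr 1
  simpa only [pow_one, add_comm 1] using (transfer_pow_green f 1 x).symm

theorem tsum_tsum_add (a : ℕ → ℝ≥0∞) : ∑' n, ∑' m, a (n + m) = ∑' n : ℕ, (n + 1) * a n := by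
  rw [← ENNReal.tsum_prod,
    ← Finset.HasAntidiagonal.sigmaAntidiagonalEquivProd.tsum_eq fun p : ℕ × ℕ => a (p.1 + p.2),
    ENNReal.tsum_sigma']
  refine tsum_congr fun n => ?_
  rw [tsum_fintype, Finset.sum_congr rfl fun p _ => show _ = a n from ?_]
  · simp
  · exact congrArg a (Finset.HasAntidiagonal.mem_antidiagonal.1 p.2)

theorem green_green_apply (f : ℕ → ℝ≥0∞) (x : ℕ) :
    green (green f) x = ∑' n : ℕ, (n + 1) * (transfer ^ n) f x := by
  rw [green_apply, ← tsum_tsum_add]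
  simp only [transfer_pow_green]

theorem green_le_of_eq_add_transfer {f v : ℕ → ℝ≥0∞} (h : v = f + transfer v) : green f ≤ v := by
  have hsum (n : ℕ) : ∑ i ∈ Finset.range n, (transfer ^ i) f + (transfer ^ n) v = v := by
    induction n with
    | zero => simp
    | succ n ih =>
      rw [Finset.sum_range_succ, add_assoc, pow_succ, Module.End.mul_apply, ← map_add, ← h, ih]
  intro x
  refine ENNReal.tsum_le_of_sum_range_le fun n => ?_
  calc ∑ i ∈ Finset.range n, (transfer ^ i) f x
      ≤ (∑ i ∈ Finset.range n, (transfer ^ i) f + (transfer ^ n) v) x := by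
        rw [Pi.add_apply, Finset.sum_apply]
        exact le_self_add
    _ = v x := by rw [hsum]

theorem toReal_transfer {f : ℕ → ℝ≥0∞} (hf : ∀ x, f x ≠ ∞) (x : ℕ) : (transfer f x).toReal =
    stepWeight x * ((f (x - 1)).toReal + (f x).toReal + (f (x + 1)).toReal) := by
  rw [transfer_apply, ENNReal.toReal_mul, toReal_avg hf, avoidProb_eq,
    ENNReal.toReal_ofReal (three_mul_stepWeight_mem_Icc x).1]
  ring

theorem transfer_ne_top {f : ℕ → ℝ≥0∞} (hf : ∀ x, f x ≠ ∞) (x : ℕ) : transfer f x ≠ ∞ :=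
  ENNReal.mul_ne_top (avoidProb_ne_top x) (ENNReal.mul_ne_top (by simp) (by simp [hf]))

theorem toReal_eq_of_eq_add_transfer {f u v : ℕ → ℝ≥0∞} {M : ℝ≥0∞} (hM : M ≠ ∞)
    (hu : ∀ x, u x ≤ M) (hv : ∀ x, v x ≤ M) (hfu : u = f + transfer u) (hfv : v = f + transfer v)
    (x : ℕ) : (u x).toReal = (v x).toReal := by
  have hreal {g : ℕ → ℝ≥0∞} (hg : ∀ x, g x ≤ M) (h : g = f + transfer g) (x : ℕ) :
      (g x).toReal = (f x).toReal +
        stepWeight x * ((g (x - 1)).toReal + (g x).toReal + (g (x + 1)).toReal) := by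
    have hfin (x : ℕ) : g x ≠ ∞ := ne_top_of_le_ne_top hM (hg x)
    have hx : g x = f x + transfer g x := congrFun h x
    rw [← toReal_transfer hfin, ← ENNReal.toReal_add _ (transfer_ne_top hfin x), ← hx]
    exact ne_top_of_le_ne_top (hfin x) (hx ▸ le_self_add)
  refine sub_eq_zero.1 (eq_zero_of_convex_of_bounded (d := fun x => (u x).toReal - (v x).toReal)
    (c := fun x => 1 / stepWeight (x + 1) - 3) (M := M.toReal) ?_ (fun x => ?_) (fun x => ?_)
    (fun x => abs_sub_le_of_nonneg_of_le ENNReal.toReal_nonneg (ENNReal.toReal_mono hM (hu x))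
      ENNReal.toReal_nonneg (ENNReal.toReal_mono hM (hv x))) x)
  · rw [hreal hu hfu 0, hreal hv hfv 0, stepWeight_zero, zero_mul, zero_mul, sub_self]
  · have hle := (three_mul_stepWeight_mem_Icc (x + 1)).2
    rw [sub_nonneg, le_div_iff₀ (stepWeight_pos x.succ_ne_zero)]
    exact hle
  · have hux := hreal hu hfu (x + 1)
    have hvx := hreal hv hfv (x + 1)
    have := stepWeight_pos x.succ_ne_zero
    rw [Nat.add_sub_cancel] at hux hvx
    field_simp
    linarith

theorem green_eq_of_bounded {f v : ℕ → ℝ≥0∞} {M : ℝ≥0∞} (hM : M ≠ ∞) (hv : ∀ x, v x ≤ M)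
    (h : v = f + transfer v) : green f = v := by
  have hgreen (x : ℕ) : green f x ≤ M := (green_le_of_eq_add_transfer h x).trans (hv x)
  funext x
  exact (ENNReal.toReal_eq_toReal_iff' (ne_top_of_le_ne_top hM (hgreen x))
    (ne_top_of_le_ne_top hM (hv x))).1
    (toReal_eq_of_eq_add_transfer hM hgreen hv (green_eq_add_transfer_green f) h x)

theorem avg_ofReal {f : ℕ → ℝ} (hf : ∀ x, 0 ≤ f x) (x : ℕ) :
    avg (fun z => ENNReal.ofReal (f z)) x =
      ENNReal.ofReal ((f (x - 1) + f x + f (x + 1)) / 3) := by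
  rw [avg, ← ENNReal.ofReal_add (hf _) (hf _),
    ← ENNReal.ofReal_add (add_nonneg (hf _) (hf _)) (hf _), div_eq_inv_mul,
    ENNReal.ofReal_mul (by norm_num), ENNReal.ofReal_inv_of_pos zero_lt_three,
    ENNReal.ofReal_ofNat]

theorem green_single_zero :
    green (Pi.single 0 1) = fun x => ENNReal.ofReal (1 - 3 * stepWeight x) := by
  have hnonneg (x : ℕ) : 0 ≤ 1 - 3 * stepWeight x :=
    sub_nonneg.2 (three_mul_stepWeight_mem_Icc x).2
  refine green_eq_of_bounded ENNReal.one_ne_top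
    (fun x => ENNReal.ofReal_le_one.2 (by linarith [stepWeight_nonneg x])) (funext fun x => ?_)
  rcases x with _ | x
  · simp [transfer_zero_right, stepWeight_zero]
  · rw [Pi.add_apply, Pi.single_eq_of_ne x.succ_ne_zero, zero_add, transfer_apply, avoidProb_eq,
      avg_ofReal hnonneg, ← ENNReal.ofReal_mul (three_mul_stepWeight_mem_Icc _).1,
      Nat.add_sub_cancel]
    congr 1
    simp only [stepWeight]
    push_cast
    field_simp
    ring

theorem green_green_single_zero : green (green (Pi.single 0 1)) = 1 := by
  refine green_eq_of_bounded ENNReal.one_ne_top (fun _ => le_rfl) (funext fun x => ?_)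
  obtain ⟨hnonneg, hle⟩ := three_mul_stepWeight_mem_Icc x
  have havg : avg 1 x = 1 := by
    rw [avg, Pi.one_apply, Pi.one_apply, Pi.one_apply, one_add_one_eq_two, two_add_one_eq_three,
      ENNReal.inv_mul_cancel three_ne_zero ENNReal.ofNat_ne_top]
  rw [Pi.add_apply, green_single_zero, transfer_apply, havg, mul_one, avoidProb_eq,
    ← ENNReal.ofReal_add (sub_nonneg.2 hle) hnonneg, sub_add_cancel, ENNReal.ofReal_one,
    Pi.one_apply]

/-! ### Asymptotics of the Green operator -/

theorem avoidProb_mul_single (y x : ℕ) :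
    avoidProb y * (Pi.single y 1 : ℕ → ℝ≥0∞) x = avoidProb x * (Pi.single y 1 : ℕ → ℝ≥0∞) x := by
  rcases eq_or_ne x y with rfl | h
  · rfl
  · rw [Pi.single_eq_of_ne h, mul_zero, mul_zero]

theorem transfer_single (y : ℕ) : transfer (Pi.single y 1) = (3⁻¹ : ℝ≥0∞) •
    (avoidProb (y - 1) • Pi.single (y - 1) 1 + avoidProb y • Pi.single y 1 +
      avoidProb (y + 1) • Pi.single (y + 1) 1) := by
  funext x
  simp only [transfer_apply, avg, Pi.smul_apply, Pi.add_apply, smul_eq_mul,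
    avoidProb_mul_single _ x]
  rcases x with _ | x
  · simp only [avoidProb_zero, zero_mul, add_zero, mul_zero]
  · have hup : (Pi.single y 1 : ℕ → ℝ≥0∞) x = (Pi.single (y + 1) 1 : ℕ → ℝ≥0∞) (x + 1) := by
      simp only [Pi.single_apply, add_left_inj]
    have hdown : (Pi.single y 1 : ℕ → ℝ≥0∞) (x + 1 + 1) =
        (Pi.single (y - 1) 1 : ℕ → ℝ≥0∞) (x + 1) := by
      simp only [Pi.single_apply, show x + 1 + 1 = y ↔ x + 1 = y - 1 by omega]
    rw [Nat.add_sub_cancel, hup, hdown]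
    ring

theorem map_transfer_single (F : (ℕ → ℝ≥0∞) →ₗ[ℝ≥0∞] (ℕ → ℝ≥0∞)) (y k : ℕ) :
    F (transfer (Pi.single y 1)) k = avg (fun z => avoidProb z * F (Pi.single z 1) k) y := by
  simp only [transfer_single, map_smul, map_add]
  rfl

theorem avoidProb_ne_zero {x : ℕ} (hx : x ≠ 0) : avoidProb x ≠ 0 := by
  rw [avoidProb_eq]
  exact (ENNReal.ofReal_pos.2 (mul_pos three_pos (stepWeight_pos hx))).ne'

theorem eq_div_of_eq_add_avg_avoidProb_mul {f : ℕ → ℝ≥0∞} {b : ℝ≥0∞} {y : ℕ}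
    (h : f y = b + avg (fun z => avoidProb z * f z) y) (hpred : f (y - 1) ≠ ∞) (hy : f y ≠ ∞) :
    f (y + 1) = (3 * (f y - b) - (avoidProb (y - 1) * f (y - 1) + avoidProb y * f y)) /
      avoidProb (y + 1) := by
  have havg : f y - b = avg (fun z => avoidProb z * f z) y :=
    (ENNReal.eq_sub_of_add_eq' hy (h.trans (add_comm _ _)).symm).symm
  rw [havg, avg, ← mul_assoc, ENNReal.mul_inv_cancel three_ne_zero ENNReal.ofNat_ne_top, one_mul,
    ENNReal.add_sub_cancel_left (by simp [ENNReal.mul_eq_top, avoidProb_ne_top, hpred, hy]),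
    mul_comm (avoidProb (y + 1)),
    ENNReal.mul_div_cancel_right (avoidProb_ne_zero y.succ_ne_zero) (avoidProb_ne_top _)]

theorem tendsto_of_eq_add_avg_avoidProb_mul {φ s : ℕ → ℕ → ℝ≥0∞} {L : ℕ → ℝ≥0∞}
    (hφ : ∀ y k, φ y k = s y k + avg (fun z => avoidProb z * φ z k) y)
    (hL : ∀ y, L y = avg (fun z => avoidProb z * L z) y) (hL_fin : ∀ y, L y ≠ ∞)
    (hs : ∀ y, Tendsto (s y) atTop (𝓝 0)) (hφ_fin : ∀ k, φ 0 k ≠ ∞)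
    (h0 : Tendsto (φ 0) atTop (𝓝 (L 0))) (y : ℕ) : Tendsto (φ y) atTop (𝓝 (L y)) := by
  suffices h : (∀ k, φ y k ≠ ∞) ∧ Tendsto (φ y) atTop (𝓝 (L y)) from h.2
  induction y using Nat.strong_induction_on with | _ y ih => ?_
  rcases y with _ | y
  · exact ⟨hφ_fin, h0⟩
  obtain ⟨hpred_fin, hpred⟩ := ih (y - 1) (by omega)
  obtain ⟨hy_fin, hy⟩ := ih y y.lt_succ_self
  have hφ_succ (k : ℕ) := eq_div_of_eq_add_avg_avoidProb_mul (f := fun z => φ z k) (hφ y k)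
    (hpred_fin k) (hy_fin k)
  have hL_succ := eq_div_of_eq_add_avg_avoidProb_mul ((hL y).trans (zero_add _).symm)
    (hL_fin (y - 1)) (hL_fin y)
  constructor
  · intro k
    rw [hφ_succ k]
    exact ENNReal.div_ne_top (ENNReal.sub_ne_top (ENNReal.mul_ne_top ENNReal.ofNat_ne_top
      (ENNReal.sub_ne_top (hy_fin k)))) (avoidProb_ne_zero y.succ_ne_zero)
  · have hmul {u : ℕ → ℝ≥0∞} {l : ℝ≥0∞} (c : ℝ≥0∞) (hc : c ≠ ∞) (hu : Tendsto u atTop (𝓝 l)) :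
        Tendsto (fun k => c * u k) atTop (𝓝 (c * l)) := ENNReal.Tendsto.const_mul hu (.inr hc)
    rw [funext hφ_succ, hL_succ]
    refine ENNReal.Tendsto.div_const (ENNReal.Tendsto.sub
      (hmul 3 ENNReal.ofNat_ne_top (ENNReal.Tendsto.sub hy (hs y) (.inl (hL_fin y))))
      ((hmul _ (avoidProb_ne_top _) hpred).add (hmul _ (avoidProb_ne_top _) hy)) (.inl ?_))
      (.inr (avoidProb_ne_zero y.succ_ne_zero))
    exact ENNReal.mul_ne_top ENNReal.ofNat_ne_top (ENNReal.sub_ne_top (hL_fin y))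

/-- The limit of `green (green (Pi.single y 1)) k` as `k → ∞`: the solution of the recursion
`avg_avoidProb_mul_greenLimit` with value `1` at `0`. -/
def greenLimit (y : ℕ) : ℝ :=
  if y = 0 then 1 else 3 / 20 * ((y + 1) * (y + 2) * (2 * y + 3))

theorem greenLimit_pos (y : ℕ) : 0 < greenLimit y := by
  unfold greenLimit; split_ifs <;> positivity

theorem stepWeight_mul_greenLimit (y : ℕ) :
    stepWeight y * greenLimit y = y * (y + 3) * (2 * y + 3) / 20 := by
  rcases eq_or_ne y 0 with rfl | hy
  · simp [stepWeight]
  · rw [stepWeight, greenLimit, if_neg hy]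
    field_simp

theorem sum_stepWeight_mul_greenLimit (y : ℕ) :
    stepWeight (y - 1) * greenLimit (y - 1) + stepWeight y * greenLimit y +
      stepWeight (y + 1) * greenLimit (y + 1) = greenLimit y := by
  simp only [stepWeight_mul_greenLimit]
  rcases y with _ | y
  · norm_num [greenLimit]
  · rw [Nat.add_sub_cancel, greenLimit, if_neg y.succ_ne_zero]
    push_cast
    ring

theorem avg_avoidProb_mul_greenLimit (y : ℕ) :
    avg (fun z => avoidProb z * ENNReal.ofReal (greenLimit z)) y =
      ENNReal.ofReal (greenLimit y) := by
  have hmul (z : ℕ) : avoidProb z * ENNReal.ofReal (greenLimit z) =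
      ENNReal.ofReal (3 * (stepWeight z * greenLimit z)) := by
    rw [avoidProb_eq, ← ENNReal.ofReal_mul (three_mul_stepWeight_mem_Icc z).1, mul_assoc]
  simp only [hmul]
  rw [avg_ofReal fun z => mul_nonneg zero_le_three
    (mul_nonneg (stepWeight_nonneg z) (greenLimit_pos z).le), ← mul_add, ← mul_add,
    mul_div_cancel_left₀ _ three_ne_zero, sum_stepWeight_mul_greenLimit]

theorem tendsto_single_apply (y : ℕ) :
    Tendsto (Pi.single y 1 : ℕ → ℝ≥0∞) atTop (𝓝 0) := by
  refine tendsto_const_nhds.congr' ?_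
  filter_upwards [eventually_gt_atTop y] with k hk
  rw [Pi.single_eq_of_ne hk.ne']

theorem tendsto_green_single (y : ℕ) : Tendsto (green (Pi.single y 1)) atTop (𝓝 0) := by
  refine tendsto_of_eq_add_avg_avoidProb_mul (φ := fun y => green (Pi.single y 1))
    (s := fun y => Pi.single y 1) (L := 0) (fun y k => ?_) (fun y => ?_)
    (fun _ => ENNReal.zero_ne_top) tendsto_single_apply (fun k => ?_) ?_ y
  · rw [← map_transfer_single, ← Pi.add_apply, ← green_eq_add_green_transfer]
  · simp [avg]
  · simp [green_single_zero]
  · simp only [green_single_zero, one_sub_three_mul_stepWeight]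
    have hprod : Tendsto (fun k : ℕ => ((k : ℝ) + 1) * (k + 2)) atTop atTop :=
      (tendsto_natCast_atTop_atTop.atTop_add tendsto_const_nhds).atTop_mul_atTop₀
        (tendsto_natCast_atTop_atTop.atTop_add tendsto_const_nhds)
    simpa using ENNReal.tendsto_ofReal (hprod.const_div_atTop 2)

theorem tendsto_green_green_single (y : ℕ) :
    Tendsto (green (green (Pi.single y 1))) atTop (𝓝 (ENNReal.ofReal (greenLimit y))) := by
  refine tendsto_of_eq_add_avg_avoidProb_mul (φ := fun y => green (green (Pi.single y 1)))
    (s := fun y => green (Pi.single y 1)) (L := fun y => ENNReal.ofReal (greenLimit y))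
    (fun y k => ?_) (fun y => (avg_avoidProb_mul_greenLimit y).symm)
    (fun _ => ENNReal.ofReal_ne_top) tendsto_green_single (fun k => ?_) ?_ y
  · have h := map_transfer_single (green ∘ₗ green) y k
    simp only [LinearMap.comp_apply] at h
    rw [← h, ← Pi.add_apply, ← map_add, ← green_eq_add_green_transfer]
  · simp [green_green_single_zero]
  · simp only [green_green_single_zero, greenLimit, if_true, ENNReal.ofReal_one]
    exact tendsto_const_nhds

/-! ### Prescribing the labels next to the end of the branch -/

theorem tsum_pathWeight_le (C : ℕ → Set ℕ) (k r : ℕ) :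
    ∑' n : ℕ, ((n + r : ℕ) + 1) * pathWeight C (n + r) k ≤
      sampleLaw {ω | ∃ m, r ≤ m ∧ ((uniformInfiniteTree ω).raise k).HitsAlong C m} := by
  set H : ℕ → Set Sample := fun m => {ω | ((uniformInfiniteTree ω).raise k).HitsAlong C m}
  have hH (m : ℕ) : MeasurableSet (H m) := measurableSet_setOfPred.2
    ((measurableTree_uniformInfiniteTree.raise measurable_const).hitsAlong C m)
  have hdisj : Pairwise (Function.onFun Disjoint fun n => H (n + r)) := fun n n' hn =>
    Set.disjoint_left.2 fun _ h h' => hn (Nat.add_right_cancel (h.height_unique h'))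
  calc ∑' n : ℕ, ((n + r : ℕ) + 1) * pathWeight C (n + r) k
      ≤ ∑' n, sampleLaw (H (n + r)) :=
        ENNReal.tsum_le_tsum fun n => succ_mul_pathWeight_le C (n + r) k
    _ = sampleLaw (⋃ n, H (n + r)) := (measure_iUnion hdisj fun n => hH _).symm
    _ ≤ _ := by
        refine measure_mono (Set.iUnion_subset fun n ω hω => ?_)
        exact ⟨n + r, Nat.le_add_left r n, hω⟩

/-- The total weight of the walk `c r, …, c 0` for the operator `transfer`. -/
def branchWeight (c : ℕ → ℕ) (r : ℕ) : ℝ≥0∞ :=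
  ∏ i ∈ Finset.range r, transfer (Pi.single (c i) 1) (c (i + 1))

theorem branchWeight_succ (c : ℕ → ℕ) (r : ℕ) :
    branchWeight c (r + 1) = branchWeight c r * transfer (Pi.single (c r) 1) (c (r + 1)) :=
  Finset.prod_range_succ _ r

theorem single_one_ne_top (y x : ℕ) : (Pi.single y 1 : ℕ → ℝ≥0∞) x ≠ ∞ := by
  rw [Pi.single_apply]
  split_ifs <;> simp

theorem branchWeight_ne_top (c : ℕ → ℕ) (r : ℕ) : branchWeight c r ≠ ∞ :=
  ENNReal.prod_ne_top fun i _ => transfer_ne_top (single_one_ne_top (c i)) (c (i + 1))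

theorem indicator_singleton_eq_smul_single (f : ℕ → ℝ≥0∞) (y : ℕ) :
    ({y} : Set ℕ).indicator f = f y • Pi.single y 1 := by
  rw [Set.indicator_singleton, ← Pi.single_smul', smul_eq_mul, mul_one]

/-- The constraint on the branch to have the labels `c 0, …, c r` at its `r + 1` first vertices. -/
def prescribed (c : ℕ → ℕ) (r i : ℕ) : Set ℕ := {a | i ≤ r → a = c i}

theorem prescribed_of_le (c : ℕ → ℕ) {r i : ℕ} (hi : i ≤ r) : prescribed c r i = {c i} :=
  Set.ext fun _ => forall_prop_of_true hi

theorem prescribed_of_lt (c : ℕ → ℕ) {r i : ℕ} (hi : r < i) : prescribed c r i = Set.univ :=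
  Set.ext fun _ => iff_of_true (fun h => absurd h hi.not_ge) trivial

theorem pathWeight_prescribed {c : ℕ → ℕ} (hc : c 0 = 0) {r m : ℕ} (hm : m ≤ r) :
    pathWeight (prescribed c r) m = branchWeight c m • Pi.single (c m) 1 := by
  induction m with
  | zero =>
    simp [pathWeight, prescribed_of_le c hm, branchWeight, hc]
  | succ m ih =>
    rw [pathWeight, prescribed_of_le c hm, indicator_singleton_eq_smul_single,
      ih (Nat.le_of_succ_le hm), map_smul, branchWeight_succ]
    rfl

theorem pathWeight_prescribed_add {c : ℕ → ℕ} (hc : c 0 = 0) (r n : ℕ) :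
    pathWeight (prescribed c r) (n + r) =
      branchWeight c r • (transfer ^ n) (Pi.single (c r) 1) := by
  induction n with
  | zero => rw [zero_add, pathWeight_prescribed hc le_rfl, pow_zero, Module.End.one_apply]
  | succ n ih =>
    rw [Nat.add_right_comm, pathWeight, prescribed_of_lt c (by omega), Set.indicator_univ, ih,
      map_smul, pow_succ', Module.End.mul_apply]

theorem branchWeight_mul_green_green_le {c : ℕ → ℕ} (hc : c 0 = 0) (k r : ℕ) :
    branchWeight c r * green (green (Pi.single (c r) 1)) k ≤
      sampleLaw {ω | ∀ i < r, (uniformInfiniteTree ω).branchLabel k (i + 1) = c (i + 1)} := by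
  calc branchWeight c r * green (green (Pi.single (c r) 1)) k
      = ∑' n : ℕ, (n + 1) * pathWeight (prescribed c r) (n + r) k := by
        rw [green_green_apply, ← ENNReal.tsum_mul_left]
        refine tsum_congr fun n => ?_
        rw [pathWeight_prescribed_add hc, Pi.smul_apply, smul_eq_mul, mul_left_comm]
    _ ≤ ∑' n : ℕ, ((n + r : ℕ) + 1) * pathWeight (prescribed c r) (n + r) k := by
        gcongr
        exact Nat.le_add_right _ r
    _ ≤ sampleLaw {ω | ∃ m, r ≤ m ∧
          ((uniformInfiniteTree ω).raise k).HitsAlong (prescribed c r) m} :=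
        tsum_pathWeight_le _ k r
    _ ≤ _ := by
        refine measure_mono ?_
        rintro ω ⟨m, hm, hω⟩ i hi
        obtain ⟨a, ha, hlabel⟩ := hω.branchLabel_eq (i := i + 1) (by omega)
        rw [hlabel, ha hi]

/-! ### The limiting chain as an h-transform -/

section Trajectory

variable {X : ℕ → Type*} [∀ n, MeasurableSpace (X n)] (μ₀ : Measure (X 0))
  (κ : (n : ℕ) → Kernel (Π i : Finset.Iic n, X i) (X (n + 1)))
  [∀ n, IsMarkovKernel (κ n)]

theorem map_eval_zero_trajMeasure : (Kernel.trajMeasure μ₀ κ).map (fun x => x 0) = μ₀ := by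
  let e : (Π i : Finset.Iic 0, X i) ≃ᵐ X 0 := MeasurableEquiv.piUnique fun i : Finset.Iic 0 => X i
  have hmap : (Kernel.trajMeasure μ₀ κ).map (Preorder.frestrictLe 0) = μ₀.map e.symm := by
    rw [Kernel.trajMeasure, Measure.map_comp _ _ (by fun_prop), Kernel.traj_map_frestrictLe,
      Kernel.partialTraj_self, Measure.id_comp]
    rfl
  calc (Kernel.trajMeasure μ₀ κ).map (fun x => x 0)
      = ((Kernel.trajMeasure μ₀ κ).map (Preorder.frestrictLe 0)).map e :=
        (Measure.map_map e.measurable (Preorder.measurable_frestrictLe 0)).symm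
    _ = μ₀ := by rw [hmap, e.map_map_symm]

theorem trajMeasure_setOf_forall_le_succ [IsProbabilityMeasure μ₀]
    [∀ n, MeasurableSingletonClass (X n)] (c : Π n, X n) (n : ℕ) :
    Kernel.trajMeasure μ₀ κ {x | ∀ i ≤ n + 1, x i = c i} =
      κ n (Preorder.frestrictLe n c) {c (n + 1)} *
        Kernel.trajMeasure μ₀ κ {x | ∀ i ≤ n, x i = c i} := by
  have hpast : {x : Π n, X n | ∀ i ≤ n, x i = c i} =
      Preorder.frestrictLe n ⁻¹' {Preorder.frestrictLe n c} := by
    ext x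
    simp [funext_iff]
  have hpath : {x : Π n, X n | ∀ i ≤ n + 1, x i = c i} =
      (fun x => (Preorder.frestrictLe n x, x (n + 1))) ⁻¹'
        ({Preorder.frestrictLe n c} ×ˢ {c (n + 1)}) := by
    ext x
    simp [funext_iff, Nat.le_succ_iff_eq_or_le, or_imp, forall_and, and_comm]
  have hS : MeasurableSet {Preorder.frestrictLe (π := X) n c} := measurableSet_singleton _
  rw [hpast, hpath, ← Measure.map_apply (by fun_prop) hS,
    ← Measure.map_apply (by fun_prop) (hS.prod (measurableSet_singleton _)),
    ← Kernel.map_frestrictLe_trajMeasure_compProd_eq_map_trajMeasure,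
    Measure.compProd_apply_prod hS (measurableSet_singleton _), lintegral_singleton]

end Trajectory

instance : IsProbabilityMeasure chainLaw := by
  unfold chainLaw
  infer_instance

theorem chainLaw_setOf_zero_eq (a : ℕ) : chainLaw {x | x 0 = a} = Measure.dirac 1 {a} := by
  rw [← map_eval_zero_trajMeasure (X := fun _ => ℕ) (Measure.dirac 1) chainKernel,
    Measure.map_apply (by fun_prop) (measurableSet_singleton a)]
  rfl

theorem chainLaw_setOf_forall_le_succ (c : ℕ → ℕ) (n : ℕ) :
    chainLaw {x | ∀ i ≤ n + 1, x i = c i} =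
      chainStep (c n) {c (n + 1)} * chainLaw {x | ∀ i ≤ n, x i = c i} :=
  trajMeasure_setOf_forall_le_succ (X := fun _ => ℕ) _ _ c n

theorem ofReal_stepWeight (z : ℕ) : ENNReal.ofReal (stepWeight z) = 3⁻¹ * avoidProb z := by
  rw [avoidProb_eq, ENNReal.ofReal_mul zero_le_three, ENNReal.ofReal_ofNat, ← mul_assoc,
    ENNReal.inv_mul_cancel (by simp) (by simp), one_mul]

theorem transfer_single_mul_greenLimit (a b : ℕ) :
    transfer (Pi.single a 1) b * ENNReal.ofReal (greenLimit b) =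
      ENNReal.ofReal (stepWeight (a - 1) * greenLimit (a - 1)) * Measure.dirac (a - 1) {b} +
        ENNReal.ofReal (stepWeight a * greenLimit a) * Measure.dirac a {b} +
        ENNReal.ofReal (stepWeight (a + 1) * greenLimit (a + 1)) * Measure.dirac (a + 1) {b} := by
  have hterm (z : ℕ) :
      3⁻¹ * (avoidProb z * (Pi.single z 1 : ℕ → ℝ≥0∞) b) * ENNReal.ofReal (greenLimit b) =
        ENNReal.ofReal (stepWeight z * greenLimit z) * Measure.dirac z {b} := by
    rcases eq_or_ne b z with rfl | hb
    · rw [← mul_assoc, ← ofReal_stepWeight, ENNReal.ofReal_mul (stepWeight_nonneg b)]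
      simp
    · simp [hb, hb.symm]
  rw [transfer_single]
  simp only [Pi.smul_apply, Pi.add_apply, smul_eq_mul, mul_add, add_mul, hterm]

theorem transfer_single_mul_greenLimit_of_ne_zero {a : ℕ} (ha : a ≠ 0) (b : ℕ) :
    transfer (Pi.single a 1) b * ENNReal.ofReal (greenLimit b) =
      ENNReal.ofReal (greenLimit a) * chainStep a {b} := by
  have hdown : stepWeight (a - 1) * greenLimit (a - 1) = greenLimit a * probDown a := by
    obtain ⟨a, rfl⟩ := Nat.exists_eq_succ_of_ne_zero ha
    rw [stepWeight_mul_greenLimit, greenLimit, if_neg ha, probDown]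
    push_cast [Nat.add_sub_cancel]
    field_simp
    ring
  have hstay : stepWeight a * greenLimit a = greenLimit a * probStay a := mul_comm _ _
  have hup : stepWeight (a + 1) * greenLimit (a + 1) = greenLimit a * probUp a := by
    rw [stepWeight_mul_greenLimit, greenLimit, if_neg ha, probUp]
    push_cast
    field_simp
    ring
  rw [transfer_single_mul_greenLimit, hdown, hstay, hup, chainStep, if_neg ha]
  simp only [Measure.add_apply, Measure.smul_apply, smul_eq_mul,
    ENNReal.ofReal_mul (greenLimit_pos a).le]
  ring

theorem transfer_single_zero_mul_greenLimit (b : ℕ) :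
    transfer (Pi.single 0 1) b * ENNReal.ofReal (greenLimit b) = Measure.dirac 1 {b} := by
  simp only [transfer_single_mul_greenLimit, stepWeight_mul_greenLimit]
  norm_num

theorem chainLaw_setOf_forall_le {c : ℕ → ℕ} (hc : c 0 = 0) (n : ℕ) :
    chainLaw {x | ∀ i ≤ n, x i = c (i + 1)} =
      branchWeight c (n + 1) * ENNReal.ofReal (greenLimit (c (n + 1))) := by
  induction n with
  | zero =>
    simp only [Nat.le_zero, forall_eq]
    rw [chainLaw_setOf_zero_eq, branchWeight_succ, mul_assoc, hc,
      transfer_single_zero_mul_greenLimit, branchWeight, Finset.prod_range_zero, one_mul]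
  | succ n ih =>
    rw [chainLaw_setOf_forall_le_succ (fun i => c (i + 1)), ih, branchWeight_succ c (n + 1)]
    rcases eq_or_ne (c (n + 1)) 0 with h0 | h0
    · rw [branchWeight_succ, h0, transfer_zero_right]
      simp only [mul_zero, zero_mul]
    · rw [mul_assoc (branchWeight c (n + 1)), transfer_single_mul_greenLimit_of_ne_zero h0]
      ring

theorem chainLaw_setOf_forall_lt {c : ℕ → ℕ} (hc : c 0 = 0) (r : ℕ) :
    chainLaw {x | ∀ i < r, x i = c (i + 1)} =
      branchWeight c r * ENNReal.ofReal (greenLimit (c r)) := by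
  cases r with
  | zero => simp [branchWeight, greenLimit, hc]
  | succ n => simpa only [Nat.lt_succ_iff] using chainLaw_setOf_forall_le hc n

/-! ### Convergence in distribution -/

theorem tendsto_of_forall_singleton_le_liminf {Ω : Type*} [MeasurableSpace Ω] [TopologicalSpace Ω]
    [OpensMeasurableSpace Ω] [HasOuterApproxClosed Ω] [MeasurableSingletonClass Ω]
    {μ : ProbabilityMeasure Ω} {μs : ℕ → ProbabilityMeasure Ω} {S : Set Ω} (hS : S.Countable)
    (hμS : (μ : Measure Ω) Sᶜ = 0)
    (h : ∀ x ∈ S, (μ : Measure Ω) {x} ≤ liminf (fun k => (μs k : Measure Ω) {x}) atTop) :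
    Tendsto μs atTop (𝓝 μ) := by
  refine tendsto_of_forall_isOpen_le_liminf' fun G _ => ?_
  have hGS : (G ∩ S).Countable := hS.mono Set.inter_subset_right
  have := hGS.to_subtype
  have hsum (ν : Measure Ω) : ν (G ∩ S) = ∫⁻ x : ↥(G ∩ S), ν {x.1} ∂Measure.count := by
    rw [lintegral_count]
    simpa using (tsum_measure_preimage_singleton hGS (f := id) (μ := ν)
      fun x _ => measurableSet_singleton x).symm
  calc (μ : Measure Ω) G = (μ : Measure Ω) (G ∩ S) := (measure_inter_conull hμS).symm
    _ = ∫⁻ x : ↥(G ∩ S), (μ : Measure Ω) {x.1} ∂Measure.count := hsum μ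
    _ ≤ ∫⁻ x : ↥(G ∩ S), liminf (fun k => (μs k : Measure Ω) {x.1}) atTop ∂Measure.count :=
        lintegral_mono fun x => h x x.2.2
    _ ≤ liminf (fun k => ∫⁻ x : ↥(G ∩ S), (μs k : Measure Ω) {x.1} ∂Measure.count) atTop :=
        lintegral_liminf_le fun k => Measurable.of_discrete
    _ = liminf (fun k => (μs k : Measure Ω) (G ∩ S)) atTop := by simp only [hsum]
    _ ≤ liminf (fun k => (μs k : Measure Ω) G) atTop :=
        liminf_le_liminf (Eventually.of_forall fun k => measure_mono Set.inter_subset_left)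

theorem chainLaw_setOf_forall_lt_le_liminf {c : ℕ → ℕ} (hc : c 0 = 0) (r : ℕ) :
    chainLaw {x | ∀ i < r, x i = c (i + 1)} ≤ liminf (fun k => sampleLaw
      {ω | ∀ i < r, (uniformInfiniteTree ω).branchLabel k (i + 1) = c (i + 1)}) atTop := by
  have hlim := ENNReal.Tendsto.const_mul (tendsto_green_green_single (c r))
    (Or.inr (branchWeight_ne_top c r))
  rw [chainLaw_setOf_forall_lt hc, ← hlim.liminf_eq]
  exact liminf_le_liminf (Eventually.of_forall fun k => branchWeight_mul_green_green_le hc k r)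

theorem chainLaw_singleton_le_liminf {r : ℕ} (c : Fin r → ℕ) :
    chainLaw {x | (fun i : Fin r => (x i : ℝ)) = fun i => (c i : ℝ)} ≤
      liminf (fun k => sampleLaw {ω | firstLabels r k ω = fun i => (c i : ℝ)}) atTop := by
  let d : ℕ → ℕ
    | 0 => 0
    | i + 1 => if h : i < r then c ⟨i, h⟩ else 0
  have hd (i : ℕ) (hi : i < r) : d (i + 1) = c ⟨i, hi⟩ := dif_pos hi
  have hchain (x : ℕ → ℕ) : (fun i : Fin r => (x i : ℝ)) = (fun i => (c i : ℝ)) ↔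
      ∀ i < r, x i = d (i + 1) := by
    simp only [funext_iff, Fin.forall_iff, Nat.cast_inj]
    exact forall₂_congr fun i hi => by rw [hd i hi]
  have hlabels (k : ℕ) (ω : Sample) : firstLabels r k ω = (fun i => (c i : ℝ)) ↔
      ∀ i < r, (uniformInfiniteTree ω).branchLabel k (i + 1) = d (i + 1) := by
    simp only [funext_iff, Fin.forall_iff, firstLabels]
    exact forall₂_congr fun i hi => by rw [hd i hi]; norm_cast
  simp only [hchain, hlabels]
  exact chainLaw_setOf_forall_lt_le_liminf rfl r

theorem tendstoInDistribution_firstLabels (r : ℕ) :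
    TendstoInDistribution (firstLabels r) atTop (fun x (i : Fin r) => (x i : ℝ))
      (fun _ => sampleLaw) chainLaw := by
  have hchain : Measurable fun (x : ℕ → ℕ) (i : Fin r) => (x i : ℝ) :=
    measurable_pi_lambda _ fun i => measurable_from_nat.comp (measurable_pi_apply _)
  have hrange : (Set.range fun (c : Fin r → ℕ) i => (c i : ℝ)).Countable := Set.countable_range _
  refine ⟨fun k => (measurable_firstLabels r k).aemeasurable, hchain.aemeasurable,
    tendsto_of_forall_singleton_le_liminf hrange ?_ ?_⟩
  · refine (Measure.map_apply hchain hrange.measurableSet.compl).trans ?_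
    convert measure_empty (μ := chainLaw)
    exact Set.eq_empty_of_forall_notMem fun x hx => hx ⟨fun i => x i, rfl⟩
  · rintro _ ⟨c, rfl⟩
    simp only [ProbabilityMeasure.coe_mk, Measure.map_apply hchain (measurableSet_singleton _),
      Measure.map_apply (measurable_firstLabels r _) (measurableSet_singleton _)]
    exact chainLaw_singleton_le_liminf c

end UIPQ

end

/-- The first `r` labels on the branch from `e_k` converge in distribution, as `k → ∞`, to the
first `r` values of the Markov chain started from `1`. -/
theorem mainTheorem6 (r : ℕ) :
    (∀ k : ℕ, Measurable (UIPQ.firstLabels r k)) ∧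
    ∀ F : (Fin r → ℝ) →ᵇ ℝ,
      Tendsto (fun k : ℕ => ∫ ω, F (UIPQ.firstLabels r k ω) ∂UIPQ.sampleLaw) atTop
        (𝓝 (∫ x : ℕ → ℕ, F (fun i : Fin r => (x i : ℝ)) ∂UIPQ.chainLaw)) := by
  refine ⟨UIPQ.measurable_firstLabels r, fun F => ?_⟩
  have hconv := UIPQ.tendstoInDistribution_firstLabels r
  have hF : StronglyMeasurable F := F.continuous.stronglyMeasurable
  have h := ProbabilityMeasure.tendsto_iff_forall_integral_tendsto.1 hconv.tendsto F
  simp only [ProbabilityMeasure.coe_mk] at h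
  rw [integral_map hconv.aemeasurable_limit hF.aestronglyMeasurable] at h
  simpa only [integral_map (hconv.forall_aemeasurable _) hF.aestronglyMeasurable] using h
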